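/- Let $n,m,p,\sigma,N$ be given, let $\mathcal P_j=(A_j,B_j,C_j,D_j)$, $1\le j\le\sigma$, be real state-space quadruples with $n$ states, $m$ inputs and $p$ outputs, let $\varphi:\{1,2,\dots\}\to\{1,\dots,\sigma\}$ be a switching sequence, and let $\mathcal P(k)=(A(k),B(k),C(k),D(k))=\mathcal P_{\varphi(k)}$. The Markov parameters are $h(k,\ell)=C(k)A(k-1)\cdots A(\ell+1)B(\ell)$ for $\ell<k$ and $h(k,k)=D(k)$. Assume: (i) every $\mathcal P_j$ is bounded-input/bounded-output stable and has McMillan degree $n$; (ii) any two consecutive switching times in $\{1,\dots,N\}$ (times $k$, $2\le k\le N$, with $\varphi(k)\ne\varphi(k-1)$) differ by at least $n$. *Algorithm 1.* Let $q=2n+1$, $r=2n$, $k'=2n+1$, $k''=N-4n$. Given an array $h(k,\ell)$, let $\mathcal H(k)$ be the $q\times r$ block matrix with blocks $h(k+i,k-1-j)$, $0\le i<q$, $0\le j<r$. For each $k'\le k\le k''+1$ let $\Sigma(k)$ be the diagonal matrix of the $n$ largest singular values of $\mathcal H(k)$ in nonincreasing order, and $U(k)$, $V(k)$ matrices of corresponding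 left and right singular vectors from a singular value decomposition of $\mathcal H(k)$. Put $\hat{\mathcal O}(k)=U(k)\Sigma(k)^{1/2}$ and $\hat{\mathcal R}(k-1)=\Sigma(k)^{1/2}V(k)^T$. For $k'\le k\le k''$ the output $\hat{\mathcal P}(k)=(\hat A(k),\hat B(k),\hat C(k),\hat D(k))$ is $$\hat A(k)=\big(J_\downarrow\hat{\mathcal O}(k+1)\big)^\dagger J_\uparrow\hat{\mathcal O}(k),\quad \hat B(k)=\text{first block column of }\hat{\mathcal R}(k),\quad \hat C(k)=\text{first block row of }\hat{\mathcal O}(k),\quad \hat D(k)=h(k,k),$$ where $J_\downarrow$ and $J_\uparrow$ delete the last and the first block row, respectively, and $X^\dagger=(X^TX)^{-1}X^T$. **Theorem.** There are $c,\varepsilon_*>0$ and a function $\omega$ with $\omega(\varepsilon)\to0$ as $\varepsilon\downarrow0$, depending only on the system and $N$, such that the following holds. Let $\hat{\mathcal P}$ be an output of Algorithm 1 on $h$, let $0<\varepsilon\le\varepsilon_*$, let $\tilde h(k,\ell)=h(k,\ell)+e(k,\ell)$ with $\|e(k,\ell)\|_F\le\varepsilon$ for $1\le\ell\le k$, $k'\le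 k\le N-2n+1$, and let $\tilde{\mathcal P}$ be an output of Algorithm 1 on $\tilde h$. Then there are a realization $\mathcal P^\varepsilon(k)=(A^\varepsilon(k),B^\varepsilon(k),C^\varepsilon(k),D^\varepsilon(k))$, $k'\le k\le k''$, and invertible matrices $S(k)\in\mathbb R^{n\times n}$, $k'\le k\le k''+1$, bounded with bounded inverses (a Lyapunov transformation), such that for all $k'\le k\le k''$ $$A^\varepsilon(k)=S(k+1)\tilde A(k)S(k)^{-1},\quad B^\varepsilon(k)=S(k+1)\tilde B(k),\quad C^\varepsilon(k)=\tilde C(k)S(k)^{-1},\quad D^\varepsilon(k)=\tilde D(k),$$ (that is, $\mathcal P^\varepsilon$ is topologically equivalent to $\tilde{\mathcal P}$), the Frobenius norms $$\|A^\varepsilon(k)-\hat A(k)\|_F,\quad\|B^\varepsilon(k)-\hat B(k)\|_F,\quad\|C^\varepsilon(k)-\hat C(k)\|_F,\quad\|D^\varepsilon(k)-\hat D(k)\|_F$$ are all at most $c\,\varepsilon$, and $S$ is asymptotically orthogonal: if $k'\le k''$, then $\|S(k)^TS(k)-I_n\|_F\le\omega(\varepsilon)$ for all $k'\le k\le k''+1$,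 so that $S(k)^TS(k)\to I_n$ as $\varepsilon\to0$. -/

import Mathlib

open Filter Topology Matrix

attribute [local instance] Matrix.frobeniusNormedAddCommGroup

/-- A state-space quadruple `(A, B, C, D)` with `n` states, `m` inputs and `p` outputs. -/
structure StateSpace (n m p : ℕ) where
  A : Matrix (Fin n) (Fin n) ℝ
  B : Matrix (Fin n) (Fin m) ℝ
  C : Matrix (Fin p) (Fin n) ℝ
  D : Matrix (Fin p) (Fin m) ℝ

namespace StateSpace

/-! Notions for a single (time-invariant) quadruple. -/

/-- State trajectory `x (k+1) = A x k + B u k` started at the origin. -/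
noncomputable def state {n m p : ℕ} (P : StateSpace n m p) (u : ℕ → Fin m → ℝ) :
    ℕ → Fin n → ℝ
  | 0 => 0
  | k + 1 => P.A *ᵥ state P u k + P.B *ᵥ u k

/-- Output `y k = C x k + D u k` for zero initial state. -/
noncomputable def output {n m p : ℕ} (P : StateSpace n m p) (u : ℕ → Fin m → ℝ) (k : ℕ) :
    Fin p → ℝ :=
  P.C *ᵥ P.state u k + P.D *ᵥ u k

/-- Bounded-input/bounded-output stability. -/
def IsBIBOStable {n m p : ℕ} (P : StateSpace n m p) : Prop :=
  ∀ u : ℕ → Fin m → ℝ, (∃ M : ℝ, ∀ k i, |u k i| ≤ M) →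
    ∃ M : ℝ, ∀ k i, |P.output u k i| ≤ M

/-- Impulse response `D, C B, C A B, C A² B, …`. -/
noncomputable def impulse {n m p : ℕ} (P : StateSpace n m p) : ℕ → Matrix (Fin p) (Fin m) ℝ
  | 0 => P.D
  | t + 1 => P.C * P.A ^ t * P.B

/-- McMillan degree: the least number of states of a time-invariant quadruple with the same
impulse response (equivalently, the same transfer function). -/
noncomputable def mcmillanDegree {n m p : ℕ} (P : StateSpace n m p) : ℕ :=
  sInf {d : ℕ | ∃ Q : StateSpace d m p, ∀ t, Q.impulse t = P.impulse t}

end StateSpace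

/-! Time-varying systems, indexed by the times `1, …, N` (other indices are never used). -/

/-- The switched linear system with discrete states `modes` and switching sequence `φ`. -/
def switchedSystem {n m p σ : ℕ} (modes : Fin σ → StateSpace n m p) (φ : ℕ → Fin σ) :
    ℕ → StateSpace n m p :=
  fun k => modes (φ k)

/-- `transitionAux P l t = A (l+t-1) ⋯ A (l+1) A l`, the product of `t` factors. -/
noncomputable def transitionAux {n m p : ℕ} (P : ℕ → StateSpace n m p) (l : ℕ) :
    ℕ → Matrix (Fin n) (Fin n) ℝ
  | 0 => 1
  | t + 1 => (P (l + t)).A * transitionAux P l t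

/-- State transition matrix `Φ(k, l) = A (k-1) ⋯ A l` for `l ≤ k`, with `Φ(k, k) = I`. -/
noncomputable def transition {n m p : ℕ} (P : ℕ → StateSpace n m p) (k l : ℕ) :
    Matrix (Fin n) (Fin n) ℝ :=
  transitionAux P l (k - l)

/-- Doubly indexed Markov parameters `h(k, l)`. -/
noncomputable def markov {n m p : ℕ} (P : ℕ → StateSpace n m p) (k l : ℕ) :
    Matrix (Fin p) (Fin m) ℝ :=
  if l < k then (P k).C * transition P k (l + 1) * (P l).B
  else if k = l then (P k).D
  else 0

/-- `k` is a switching time in `{1, …, N}`: a new segment starts at `k`. -/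
def IsSwitch {σ : ℕ} (N : ℕ) (φ : ℕ → Fin σ) (k : ℕ) : Prop :=
  2 ≤ k ∧ k ≤ N ∧ φ k ≠ φ (k - 1)

/-- The minimum dwell time is at least `d`: any two consecutive switching times differ by at
least `d`. The first and the last segment of `{1, …, N}` are not constrained. -/
def MinDwellAtLeast {σ : ℕ} (N : ℕ) (φ : ℕ → Fin σ) (d : ℕ) : Prop :=
  ∀ k l : ℕ, IsSwitch N φ k → IsSwitch N φ l → k < l →
    (∀ j, k < j → j < l → ¬ IsSwitch N φ j) → k + d ≤ l

/-- `T` is a Lyapunov transformation from `P` to `P'` over the set of times `K`: on the times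
involved (`K` and `K + 1`) it is bounded with bounded inverse, and it transforms `P` to `P'`. -/
def IsLyapunovTransformOn {n m p : ℕ} (K : Set ℕ) (T : ℕ → Matrix (Fin n) (Fin n) ℝ)
    (P P' : ℕ → StateSpace n m p) : Prop :=
  (∃ M : ℝ, ∀ k ∈ K, ∀ j ∈ ({k, k + 1} : Set ℕ),
    IsUnit (T j).det ∧ ‖T j‖ ≤ M ∧ ‖(T j)⁻¹‖ ≤ M) ∧
  ∀ k ∈ K,
    (P' k).A = T (k + 1) * (P k).A * (T k)⁻¹ ∧
    (P' k).B = T (k + 1) * (P k).B ∧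
    (P' k).C = (P k).C * (T k)⁻¹ ∧
    (P' k).D = (P k).D

/-! Hankel matrices, singular value decompositions and the realization algorithm. -/

/-- Block Hankel matrix with block entries `h(k+i, k-1-j)`, `0 ≤ i < q`, `0 ≤ j < r`. -/
def hankel {m p : ℕ} (q r : ℕ) (h : ℕ → ℕ → Matrix (Fin p) (Fin m) ℝ) (k : ℕ) :
    Matrix (Fin q × Fin p) (Fin r × Fin m) ℝ :=
  Matrix.of fun i j => h (k + i.1) (k - 1 - j.1) i.2 j.2

/-- `U`, `s`, `V` are the leading `n` left singular vectors, singular values and right singular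
vectors of `H` in some singular value decomposition
`H = [U Uₑ] (diag(s) ⊕ Σₑ) [V Vₑ]ᵀ`
with `[U Uₑ]`, `[V Vₑ]` square orthogonal, `Σₑ` rectangular diagonal with diagonal `t 0, t 1, …`,
and all the singular values nonnegative and listed in nonincreasing order. -/
def IsLeadingSVD {ι κ : Type} [Fintype ι] [Fintype κ] [DecidableEq ι] [DecidableEq κ] {n : ℕ}
    (H : Matrix ι κ ℝ) (U : Matrix ι (Fin n) ℝ) (s : Fin n → ℝ) (V : Matrix κ (Fin n) ℝ) :
    Prop :=
  ∃ (a b : ℕ) (Ue : Matrix ι (Fin a) ℝ) (Ve : Matrix κ (Fin b) ℝ) (t : ℕ → ℝ),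
    (fromCols U Ue)ᵀ * fromCols U Ue = 1 ∧ fromCols U Ue * (fromCols U Ue)ᵀ = 1 ∧
    (fromCols V Ve)ᵀ * fromCols V Ve = 1 ∧ fromCols V Ve * (fromCols V Ve)ᵀ = 1 ∧
    Antitone s ∧ Antitone t ∧ (∀ i j, t j ≤ s i) ∧ (∀ j, 0 ≤ t j) ∧
    H = fromCols U Ue *
      fromBlocks (diagonal s) 0 0
        (Matrix.of fun (i : Fin a) (j : Fin b) => if (i : ℕ) = (j : ℕ) then t i else 0) *
      (fromCols V Ve)ᵀ

/-- Block-row shift `[0 I]`, which drops the first block row. -/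
def shiftUp (q p : ℕ) : Matrix (Fin q × Fin p) (Fin (q + 1) × Fin p) ℝ :=
  Matrix.of fun i j => if j.1 = i.1.succ ∧ j.2 = i.2 then 1 else 0

/-- Block-row shift `[I 0]`, which drops the last block row. -/
def shiftDown (q p : ℕ) : Matrix (Fin q × Fin p) (Fin (q + 1) × Fin p) ℝ :=
  Matrix.of fun i j => if j.1 = i.1.castSucc ∧ j.2 = i.2 then 1 else 0

/-- `[I 0 ⋯ 0]`, which selects the first block row. -/
def selectC (q p : ℕ) : Matrix (Fin p) (Fin q × Fin p) ℝ :=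
  Matrix.of fun i j => if (j.1 : ℕ) = 0 ∧ j.2 = i then 1 else 0

/-- `[I 0 ⋯ 0]ᵀ`, which selects the first block column. -/
def selectB (r m : ℕ) : Matrix (Fin r × Fin m) (Fin m) ℝ :=
  Matrix.of fun i j => if (i.1 : ℕ) = 0 ∧ i.2 = j then 1 else 0

/-- Left inverse `(XᵀX)⁻¹Xᵀ` of a matrix of full column rank. -/
noncomputable def leftInv {ι : Type} [Fintype ι] {n : ℕ} (X : Matrix ι (Fin n) ℝ) :
    Matrix (Fin n) ι ℝ :=
  (Xᵀ * X)⁻¹ * Xᵀ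

/-- The times `2n+1 ≤ k ≤ N-4n` at which the algorithm estimates the system. -/
def estimationTimes (n N : ℕ) : Set ℕ :=
  {k | 2 * n + 1 ≤ k ∧ k + 4 * n ≤ N}

/-- `Phat` is an output of the realization algorithm, with `q = 2n+1` and `r = 2n`, on the Markov
parameters `h`. Singular value decompositions are not unique; any choice is admitted, one for each
Hankel matrix. With `O k = U k Σ(k)^{1/2}` and `R k = Σ(k)^{1/2} V(k)ᵀ` (`R k` estimates the
controllability matrix ending at time `k-1`) the estimates are `A k = (J↓ O(k+1))† J↑ O(k)`,
`B k = R(k+1) J_B`, `C k = J_C O(k)`, `D k = h(k, k)`. -/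
def IsAlgorithmOutput {n m p : ℕ} (N : ℕ) (h : ℕ → ℕ → Matrix (Fin p) (Fin m) ℝ)
    (Phat : ℕ → StateSpace n m p) : Prop :=
  ∃ (U : ℕ → Matrix (Fin (2 * n + 1) × Fin p) (Fin n) ℝ) (s : ℕ → Fin n → ℝ)
    (V : ℕ → Matrix (Fin (2 * n) × Fin m) (Fin n) ℝ)
    (O : ℕ → Matrix (Fin (2 * n + 1) × Fin p) (Fin n) ℝ)
    (R : ℕ → Matrix (Fin n) (Fin (2 * n) × Fin m) ℝ),
    (∀ k, O k = U k * diagonal fun i => Real.sqrt (s k i)) ∧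
    (∀ k, R k = (diagonal fun i => Real.sqrt (s k i)) * (V k)ᵀ) ∧
    ∀ k ∈ estimationTimes n N,
      IsLeadingSVD (hankel (2 * n + 1) (2 * n) h k) (U k) (s k) (V k) ∧
      IsLeadingSVD (hankel (2 * n + 1) (2 * n) h (k + 1)) (U (k + 1)) (s (k + 1)) (V (k + 1)) ∧
      (Phat k).A = leftInv (shiftDown (2 * n) p * O (k + 1)) * (shiftUp (2 * n) p * O k) ∧
      (Phat k).B = R (k + 1) * selectB (2 * n) m ∧
      (Phat k).C = selectC (2 * n + 1) p * O k ∧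
      (Phat k).D = h k k

/-- The noise `e` has Frobenius size at most `ε` on the Markov parameters `h(k, l)`,
`1 ≤ l ≤ k`, `2n+1 ≤ k ≤ N-2n+1`, which include all those that the algorithm reads. -/
def NoiseBounded {m p : ℕ} (n N : ℕ) (ε : ℝ) (e : ℕ → ℕ → Matrix (Fin p) (Fin m) ℝ) : Prop :=
  ∀ k l : ℕ, 1 ≤ l → l ≤ k → 2 * n + 1 ≤ k → k + 2 * n ≤ N + 1 → ‖e k l‖ ≤ ε

/-!
At every relevant time the exact Hankel matrix is a product of an observability and a
controllability matrix of full rank `n`, because the dwell time leaves `n` steps of a single minimal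
mode in each window of length `2n`. The truncated singular value decomposition of a perturbed Hankel
matrix is a best rank-`n` approximation, so the products `O' R'` and `O R` of the noisy and exact
factors differ by `O(ε)`; multiplying `O'` by a left inverse `L` of `O` gives the basis change
`S = L O'`, with `O' S⁻¹ = O + O(ε)` and `S R' = R + O(ε)`; the estimates of the quadruples follow.
No gap between the singular values is needed. Since the singular values are split evenly, both pairs
of factors are balanced, `Oᵀ O = R Rᵀ =: Γ` and `O'ᵀ O' = R' R'ᵀ`, whence `S Sᵀ Γ S Sᵀ = Γ + O(ε)`.
As `Γ` is positive definite this forces `S Sᵀ = 1 + O(ε)`.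
-/

section Frobenius

variable {𝕜 ι κ : Type*} [RCLike 𝕜] [Fintype ι] [Fintype κ]

theorem frobenius_norm_sq (A : Matrix ι κ 𝕜) : ‖A‖ ^ 2 = ∑ i, ∑ j, ‖A i j‖ ^ 2 := by
  rw [frobenius_norm_def, ← Real.rpow_natCast, ← Real.rpow_mul (by positivity)]
  norm_num

theorem frobenius_norm_le_of_forall_norm_le {A : Matrix ι κ 𝕜} {r : ℝ} (hr : 0 ≤ r)
    (hA : ∀ i j, ‖A i j‖ ≤ r) : ‖A‖ ≤ √(Fintype.card ι * Fintype.card κ) * r := by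
  refine le_of_sq_le_sq ?_ (by positivity)
  calc ‖A‖ ^ 2 = ∑ i, ∑ j, ‖A i j‖ ^ 2 := frobenius_norm_sq A
    _ ≤ ∑ _i : ι, ∑ _j : κ, r ^ 2 := by gcongr with i _ j _; exact hA i j
    _ = (√(Fintype.card ι * Fintype.card κ) * r) ^ 2 := by
      rw [mul_pow, Real.sq_sqrt (by positivity)]
      simp [mul_assoc]

theorem norm_entry_le_frobenius_norm (A : Matrix ι κ 𝕜) (i : ι) (j : κ) : ‖A i j‖ ≤ ‖A‖ := by
  refine le_of_sq_le_sq ?_ (norm_nonneg A)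
  rw [frobenius_norm_sq, ← Fintype.sum_prod_type']
  exact Finset.single_le_sum (f := fun x : ι × κ => ‖A x.1 x.2‖ ^ 2)
    (fun _ _ => by positivity) (Finset.mem_univ (i, j))

theorem frobenius_norm_submatrix_le {ι' κ' : Type*} [Fintype ι'] [Fintype κ'] (A : Matrix ι κ 𝕜)
    {f : ι' → ι} {g : κ' → κ} (hf : f.Injective) (hg : g.Injective) :
    ‖A.submatrix f g‖ ≤ ‖A‖ := by
  refine le_of_sq_le_sq ?_ (norm_nonneg A)
  rw [frobenius_norm_sq, frobenius_norm_sq, ← Fintype.sum_prod_type', ← Fintype.sum_prod_type',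
    ← tsum_fintype (L := .unconditional _), ← tsum_fintype (L := .unconditional _)]
  exact tsum_comp_le_tsum_of_inj (f := fun x : ι × κ => ‖A x.1 x.2‖ ^ 2) .of_finite
    (fun _ => by positivity) (hf.prodMap hg)

theorem frobenius_norm_sq_eq_trace (A : Matrix ι κ ℝ) : ‖A‖ ^ 2 = trace (A * Aᵀ) := by
  rw [frobenius_norm_sq]
  simp [trace, mul_apply, sq]

theorem abs_trace_mul_le (A : Matrix ι κ ℝ) (B : Matrix κ ι ℝ) :
    |trace (A * B)| ≤ ‖A‖ * ‖B‖ := by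
  refine abs_le_of_sq_le_sq ?_ (by positivity)
  calc trace (A * B) ^ 2 = (∑ x : ι × κ, A x.1 x.2 * Bᵀ x.1 x.2) ^ 2 := by
        simp [trace, mul_apply, Fintype.sum_prod_type]
    _ ≤ (∑ x : ι × κ, A x.1 x.2 ^ 2) * ∑ x : ι × κ, Bᵀ x.1 x.2 ^ 2 :=
        Finset.sum_mul_sq_le_sq_mul_sq _ _ _
    _ = ‖A‖ ^ 2 * ‖B‖ ^ 2 := by
        rw [← frobenius_norm_transpose B, frobenius_norm_sq, frobenius_norm_sq]
        simp [Fintype.sum_prod_type]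
    _ = (‖A‖ * ‖B‖) ^ 2 := (mul_pow _ _ 2).symm

variable {ν : Type*} [Fintype ν] [DecidableEq κ]

theorem frobenius_norm_isometry_mul {Q : Matrix ι κ ℝ} (hQ : Qᵀ * Q = 1) (A : Matrix κ ν ℝ) :
    ‖Q * A‖ = ‖A‖ := by
  rw [← sq_eq_sq₀ (norm_nonneg _) (norm_nonneg _), frobenius_norm_sq_eq_trace,
    frobenius_norm_sq_eq_trace, transpose_mul, ← Matrix.mul_assoc, trace_mul_comm,
    ← Matrix.mul_assoc, ← Matrix.mul_assoc, hQ, Matrix.one_mul]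

theorem frobenius_norm_mul_isometry_transpose {Q : Matrix ι κ ℝ} (hQ : Qᵀ * Q = 1)
    (A : Matrix ν κ ℝ) : ‖A * Qᵀ‖ = ‖A‖ := by
  rw [← frobenius_norm_transpose, transpose_mul, transpose_transpose,
    frobenius_norm_isometry_mul hQ, frobenius_norm_transpose]

theorem frobenius_norm_sq_isometry {Q : Matrix ι κ ℝ} (hQ : Qᵀ * Q = 1) :
    ‖Q‖ ^ 2 = Fintype.card κ := by
  rw [frobenius_norm_sq_eq_trace, trace_mul_comm, hQ, trace_one]

end Frobenius

section BigO

open Asymptotics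

variable {Ω 𝕜 ι κ ν : Type*} {l : Filter Ω} [RCLike 𝕜] [Fintype ι] [Fintype κ] [Fintype ν]
  {f g : Ω → ℝ}

theorem eventually_forall_norm_le {α E F : Type*} [SeminormedAddCommGroup E]
    [SeminormedAddCommGroup F] {T : Set α} (hT : T.Finite) {u : α → Ω → E} {v : Ω → F}
    (hu : ∀ a ∈ T, u a =O[l] v) :
    ∀ᶠ c : ℝ in atTop, ∀ᶠ ω in l, ∀ a ∈ T, ‖u a ω‖ ≤ c * ‖v ω‖ := by
  simp only [eventually_all_finite hT]
  exact fun a ha => isBigO_iff_eventually.1 (hu a ha)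

theorem isBigO_matrix_mul {X : Ω → Matrix ι κ 𝕜} {Y : Ω → Matrix κ ν 𝕜} (hX : X =O[l] f)
    (hY : Y =O[l] g) : (fun ω => X ω * Y ω) =O[l] fun ω => f ω * g ω :=
  (isBigO_of_le l fun ω => by
    simpa using frobenius_norm_mul (X ω) (Y ω)).trans (hX.norm_left.mul hY.norm_left)

theorem isBigO_matrix_mul_of_bounded_left {X : Ω → Matrix ι κ 𝕜} {Y : Ω → Matrix κ ν 𝕜}
    (hX : X =O[l] fun _ => (1 : ℝ)) (hY : Y =O[l] g) : (fun ω => X ω * Y ω) =O[l] g := by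
  simpa using isBigO_matrix_mul hX hY

theorem isBigO_matrix_mul_of_bounded_right {X : Ω → Matrix ι κ 𝕜} {Y : Ω → Matrix κ ν 𝕜}
    (hX : X =O[l] g) (hY : Y =O[l] fun _ => (1 : ℝ)) : (fun ω => X ω * Y ω) =O[l] g := by
  simpa using isBigO_matrix_mul hX hY

theorem isBigO_matrix_transpose {X : Ω → Matrix ι κ 𝕜} (hX : X =O[l] g) :
    (fun ω => (X ω)ᵀ) =O[l] g :=
  (isBigO_of_le l fun ω => (frobenius_norm_transpose (X ω)).le).trans hX

theorem isBigO_one_of_sub {X X' : Ω → Matrix ι κ 𝕜} (hg : Tendsto g l (𝓝 0))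
    (hX : X =O[l] fun _ => (1 : ℝ)) (h : (fun ω => X' ω - X ω) =O[l] g) :
    X' =O[l] fun _ => (1 : ℝ) := by
  simpa using (h.trans (hg.isBigO_one ℝ)).add hX

theorem isBigO_matrix_mul_sub_mul {X X' : Ω → Matrix ι κ 𝕜} {Y Y' : Ω → Matrix κ ν 𝕜}
    (hX' : X' =O[l] fun _ => (1 : ℝ)) (hY : Y =O[l] fun _ => (1 : ℝ))
    (hXX' : (fun ω => X' ω - X ω) =O[l] g) (hYY' : (fun ω => Y' ω - Y ω) =O[l] g) :
    (fun ω => X' ω * Y' ω - X ω * Y ω) =O[l] g := by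
  refine ((isBigO_matrix_mul_of_bounded_left hX' hYY').add
    (isBigO_matrix_mul_of_bounded_right hXX' hY)).congr_left fun ω => ?_
  simp [Matrix.mul_sub, Matrix.sub_mul]

theorem isBigO_gram_sub_gram {X X' : Ω → Matrix ι κ 𝕜} (hg : Tendsto g l (𝓝 0))
    (hX : X =O[l] fun _ => (1 : ℝ)) (h : (fun ω => X' ω - X ω) =O[l] g) :
    (fun ω => (X' ω)ᵀ * X' ω - (X ω)ᵀ * X ω) =O[l] g :=
  isBigO_matrix_mul_sub_mul (isBigO_matrix_transpose (isBigO_one_of_sub hg hX h)) hX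
    (by simpa only [transpose_sub] using isBigO_matrix_transpose h) h

variable [DecidableEq ι]

theorem isUnit_det_of_norm_sub_one_lt_one {M : Matrix ι ι 𝕜} (hM : ‖M - 1‖ < 1) :
    IsUnit M.det := by
  let := frobeniusNormedRing (m := ι) (α := 𝕜)
  let := frobeniusNormedAlgebra (m := ι) (R := 𝕜) (α := 𝕜)
  have : @CompleteSpace (Matrix ι ι 𝕜) PseudoMetricSpace.toUniformSpace :=
    FiniteDimensional.complete 𝕜 _
  rw [norm_sub_rev] at hM
  simpa [isUnit_iff_isUnit_det] using isUnit_one_sub_of_norm_lt_one hM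

/-- Near the identity, inversion is Lipschitz: `M⁻¹ - 1 = M⁻¹ (1 - M)` is negligible with respect to
`M⁻¹`, which is therefore bounded. -/
theorem eventually_isUnit_det_and_isBigO_inv_sub_one {M : Ω → Matrix ι ι 𝕜}
    (hg : Tendsto g l (𝓝 0)) (hM : (fun ω => M ω - 1) =O[l] g) :
    (∀ᶠ ω in l, IsUnit (M ω).det) ∧ (fun ω => (M ω)⁻¹ - 1) =O[l] g := by
  have hunit : ∀ᶠ ω in l, IsUnit (M ω).det := by
    have := (hM.trans_tendsto hg).norm
    rw [norm_zero] at this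
    exact (this.eventually_lt_const one_pos).mono fun ω => isUnit_det_of_norm_sub_one_lt_one
  have hid : (fun ω => (M ω)⁻¹ * -(M ω - 1)) =ᶠ[l] fun ω => (M ω)⁻¹ - 1 :=
    hunit.mono fun ω h => by simp [Matrix.mul_sub, nonsing_inv_mul _ h]
  have hlittle : (fun ω => (M ω)⁻¹ - 1) =o[l] fun ω => (M ω)⁻¹ := by
    have hnorm := isBigO_refl (fun ω => ‖(M ω)⁻¹‖) l
    have h := hnorm.mul_isLittleO ((isLittleO_one_iff ℝ).2 hg)
    simp only [mul_one] at h
    have hmul := (isBigO_matrix_mul hnorm.of_norm_left hM.neg_left).trans_isLittleO h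
    exact hmul.of_norm_right.congr' hid .rfl
  have hbdd : (fun ω => (M ω)⁻¹) =O[l] fun _ => (1 : ℝ) := by
    refine hlittle.right_isBigO_sub.trans ?_
    simpa using isBigO_const_const (1 : Matrix ι ι 𝕜) (one_ne_zero (α := ℝ)) l
  exact ⟨hunit, (isBigO_matrix_mul_of_bounded_left hbdd hM.neg_left).congr' hid .rfl⟩

theorem isBigO_matrix_inv_sub_inv {G K : Ω → Matrix ι ι 𝕜}
    (hg : Tendsto g l (𝓝 0)) (hG : ∀ᶠ ω in l, IsUnit (G ω).det)
    (hGinv : (fun ω => (G ω)⁻¹) =O[l] fun _ => (1 : ℝ)) (hK : (fun ω => K ω - G ω) =O[l] g) :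
    (fun ω => (K ω)⁻¹ - (G ω)⁻¹) =O[l] g := by
  have hM : (fun ω => (G ω)⁻¹ * K ω - 1) =O[l] g :=
    (isBigO_matrix_mul_of_bounded_left hGinv hK).congr'
      (hG.mono fun ω h => by simp [Matrix.mul_sub, nonsing_inv_mul _ h]) .rfl
  obtain ⟨-, hinv⟩ := eventually_isUnit_det_and_isBigO_inv_sub_one hg hM
  refine (isBigO_matrix_mul_of_bounded_right hinv hGinv).congr' (hG.mono fun ω h => ?_) .rfl
  simp [Matrix.sub_mul, Matrix.mul_inv_rev, nonsing_inv_nonsing_inv _ h, Matrix.mul_assoc,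
    mul_nonsing_inv _ h]

end BigO

section BalancedFactors

open Asymptotics

variable {ι κ ν : Type*} [Fintype ι] [Fintype κ] [Fintype ν] [DecidableEq ν]

/-- Expanding `Γ (S Sᵀ Γ S Sᵀ - Γ)` with `Γ = Oᵀ O` shows that its trace against `D = S Sᵀ - 1` is a
sum of two squares, `‖O D Oᵀ‖² + ‖D Γ S‖²`. -/
theorem norm_mul_gram_sub_one_mul_transpose_sq_le (O : Matrix ι ν ℝ) (S : Matrix ν ν ℝ) :
    ‖O * (S * Sᵀ - 1) * Oᵀ‖ ^ 2 ≤
      ‖S * Sᵀ - 1‖ * ‖Oᵀ * O * (S * Sᵀ * (Oᵀ * O) * (S * Sᵀ) - Oᵀ * O)‖ := by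
  set D := S * Sᵀ - 1 with hD
  set Γ := Oᵀ * O with hΓ
  have hDt : Dᵀ = D := by simp [hD]
  have hΓt : Γᵀ = Γ := by simp [hΓ]
  have hsplit : S * Sᵀ * Γ * (S * Sᵀ) - Γ = D * Γ + S * Sᵀ * Γ * D := by
    rw [hD]; noncomm_ring
  have htrace : trace (D * (Γ * (S * Sᵀ * Γ * (S * Sᵀ) - Γ))) =
      ‖O * D * Oᵀ‖ ^ 2 + ‖D * Γ * S‖ ^ 2 := by
    rw [frobenius_norm_sq_eq_trace, frobenius_norm_sq_eq_trace, hsplit, Matrix.mul_add,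
      Matrix.mul_add, trace_add]
    congr 1
    · rw [trace_mul_comm (O * D * Oᵀ)]
      simp only [transpose_mul, transpose_transpose, hDt, Matrix.mul_assoc]
      rw [trace_mul_comm O]
      simp only [hΓ, Matrix.mul_assoc]
    · simp only [transpose_mul, hDt, hΓt, Matrix.mul_assoc]
  calc ‖O * D * Oᵀ‖ ^ 2 ≤ trace (D * (Γ * (S * Sᵀ * Γ * (S * Sᵀ) - Γ))) := by
        rw [htrace]; linarith [sq_nonneg ‖D * Γ * S‖]
    _ ≤ _ := (le_abs_self _).trans (abs_trace_mul_le _ _)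

theorem norm_gram_sub_one_le {L : Matrix ν ι ℝ} {O : Matrix ι ν ℝ} (hL : L * O = 1)
    (S : Matrix ν ν ℝ) :
    ‖S * Sᵀ - 1‖ ≤ ‖L‖ ^ 4 * ‖Oᵀ * O * (S * Sᵀ * (Oᵀ * O) * (S * Sᵀ) - Oᵀ * O)‖ := by
  set D := S * Sᵀ - 1
  set r := ‖Oᵀ * O * (S * Sᵀ * (Oᵀ * O) * (S * Sᵀ) - Oᵀ * O)‖
  rcases (norm_nonneg D).eq_or_lt with h0 | hpos
  · rw [← h0]; positivity
  have hLD : D = L * (O * D * Oᵀ) * Lᵀ := by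
    calc D = L * O * D * (L * O)ᵀ := by simp [hL]
      _ = _ := by simp only [transpose_mul, Matrix.mul_assoc]
  have hnorm : ‖D‖ ≤ ‖L‖ * ‖O * D * Oᵀ‖ * ‖L‖ := by
    calc ‖D‖ = ‖L * (O * D * Oᵀ) * Lᵀ‖ := congrArg _ hLD
      _ ≤ ‖L * (O * D * Oᵀ)‖ * ‖Lᵀ‖ := frobenius_norm_mul _ _
      _ ≤ _ := by rw [frobenius_norm_transpose]; gcongr; exact frobenius_norm_mul _ _
  refine le_of_mul_le_mul_left ?_ hpos
  calc ‖D‖ * ‖D‖ ≤ (‖L‖ * ‖O * D * Oᵀ‖ * ‖L‖) * (‖L‖ * ‖O * D * Oᵀ‖ * ‖L‖) := by gcongr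
    _ = ‖L‖ ^ 4 * ‖O * D * Oᵀ‖ ^ 2 := by ring
    _ ≤ ‖L‖ ^ 4 * (‖D‖ * r) := by
        gcongr; exact norm_mul_gram_sub_one_mul_transpose_sq_le O S
    _ = ‖D‖ * (‖L‖ ^ 4 * r) := by ring

variable {Ω : Type*} {l : Filter Ω} {g : Ω → ℝ}

/-- Along `l`, the change of basis `S` is bounded with bounded inverse and carries the factorization
`O' * R'` to one that agrees with `O * R` up to `O(g)`. -/
structure IsFactorTransform (l : Filter Ω) (g : Ω → ℝ) (O O' : Ω → Matrix ι ν ℝ)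
    (R R' : Ω → Matrix ν κ ℝ) (S : Ω → Matrix ν ν ℝ) : Prop where
  eventually_isUnit_det : ∀ᶠ ω in l, IsUnit (S ω).det
  bounded : S =O[l] fun _ => (1 : ℝ)
  bounded_inv : (fun ω => (S ω)⁻¹) =O[l] fun _ => (1 : ℝ)
  left_sub : (fun ω => O' ω * (S ω)⁻¹ - O ω) =O[l] g
  right_sub : (fun ω => S ω * R' ω - R ω) =O[l] g

variable {O O' : Ω → Matrix ι ν ℝ} {R R' : Ω → Matrix ν κ ℝ} {L : Ω → Matrix ν ι ℝ}
  {G : Ω → Matrix κ ν ℝ} {S : Ω → Matrix ν ν ℝ}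

theorem isFactorTransform_of_product_sub (hg : Tendsto g l (𝓝 0)) (hLO : ∀ ω, L ω * O ω = 1)
    (hRG : ∀ ω, R ω * G ω = 1) (hL : L =O[l] fun _ => (1 : ℝ)) (hG : G =O[l] fun _ => (1 : ℝ))
    (hO : O =O[l] fun _ => (1 : ℝ)) (hO' : O' =O[l] fun _ => (1 : ℝ))
    (hR' : R' =O[l] fun _ => (1 : ℝ)) (hsub : (fun ω => O' ω * R' ω - O ω * R ω) =O[l] g) :
    IsFactorTransform l g O O' R R' fun ω => L ω * O' ω := by
  have hright : (fun ω => L ω * O' ω * R' ω - R ω) =O[l] g :=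
    (isBigO_matrix_mul_of_bounded_left hL hsub).congr_left fun ω => by
      rw [Matrix.mul_sub, ← Matrix.mul_assoc, ← Matrix.mul_assoc, hLO, Matrix.one_mul]
  have hM : (fun ω => L ω * O' ω * R' ω * G ω - 1) =O[l] g :=
    (isBigO_matrix_mul_of_bounded_right hright hG).congr_left fun ω => by
      rw [Matrix.sub_mul, hRG]
  obtain ⟨hunit, hinv⟩ := eventually_isUnit_det_and_isBigO_inv_sub_one hg hM
  set W := fun ω => (L ω * O' ω * R' ω * G ω)⁻¹
  have hW : W =O[l] fun _ => (1 : ℝ) :=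
    isBigO_one_of_sub hg (isBigO_const_const (1 : Matrix ν ν ℝ) one_ne_zero l) hinv
  have hSinv : ∀ᶠ ω in l, L ω * O' ω * (R' ω * G ω * W ω) = 1 := hunit.mono fun ω h => by
    simpa only [W, Matrix.mul_assoc] using mul_nonsing_inv _ h
  refine ⟨hSinv.mono fun ω h => isUnit_det_of_right_inverse h,
    isBigO_matrix_mul_of_bounded_left hL hO', ?_, ?_, hright⟩
  · exact (isBigO_matrix_mul_of_bounded_left (isBigO_matrix_mul_of_bounded_left hR' hG) hW).congr'
      (hSinv.mono fun ω h => (inv_eq_right_inv h).symm) .rfl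
  · refine ((isBigO_matrix_mul_of_bounded_right hsub
      (isBigO_matrix_mul_of_bounded_left hG hW)).add
      (isBigO_matrix_mul_of_bounded_left hO hinv)).congr' (hSinv.mono fun ω h => ?_) .rfl
    beta_reduce
    rw [inv_eq_right_inv h]
    simp only [Matrix.sub_mul, Matrix.mul_sub, ← Matrix.mul_assoc, W]
    rw [Matrix.mul_assoc (O ω) (R ω), hRG]
    simp

namespace IsFactorTransform

/-- Both Gram matrices of the transformed factors agree with the common Gram matrix of `O` and `R`.
Comparing them shows that `S Sᵀ` almost commutes past it in the sense `S Sᵀ Γ S Sᵀ ≈ Γ`. -/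
theorem gram_mul_gram_mul_gram_sub (hS : IsFactorTransform l g O O' R R' S)
    (hg : Tendsto g l (𝓝 0)) (hO : O =O[l] fun _ => (1 : ℝ)) (hR : R =O[l] fun _ => (1 : ℝ))
    (hbal : ∀ ω, (O ω)ᵀ * O ω = R ω * (R ω)ᵀ) (hbal' : ∀ ω, (O' ω)ᵀ * O' ω = R' ω * (R' ω)ᵀ) :
    (fun ω => S ω * (S ω)ᵀ * ((O ω)ᵀ * O ω) * (S ω * (S ω)ᵀ) - (O ω)ᵀ * O ω) =O[l] g := by
  have hright : (fun ω => S ω * ((O' ω)ᵀ * O' ω) * (S ω)ᵀ - (O ω)ᵀ * O ω) =O[l] g := by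
    have hRt := isBigO_gram_sub_gram hg (isBigO_matrix_transpose hR)
      (by simpa only [transpose_sub] using isBigO_matrix_transpose hS.right_sub)
    refine hRt.congr_left fun ω => ?_
    simp only [hbal, hbal', transpose_mul, transpose_transpose, Matrix.mul_assoc]
  have hleft := isBigO_matrix_mul_of_bounded_right
    (isBigO_matrix_mul_of_bounded_left (isBigO_matrix_mul_of_bounded_left hS.bounded
      (isBigO_matrix_transpose hS.bounded)) (isBigO_gram_sub_gram hg hO hS.left_sub))
    (isBigO_matrix_mul_of_bounded_left hS.bounded (isBigO_matrix_transpose hS.bounded))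
  refine (hright.sub hleft).congr' (hS.eventually_isUnit_det.mono fun ω h => ?_) .rfl
  have hcancel : O' ω * (S ω)⁻¹ * (S ω * (S ω)ᵀ) = O' ω * (S ω)ᵀ := by
    rw [Matrix.mul_assoc, nonsing_inv_mul_cancel_left _ _ h]
  have hgram : S ω * (S ω)ᵀ * ((O' ω * (S ω)⁻¹)ᵀ * (O' ω * (S ω)⁻¹)) * (S ω * (S ω)ᵀ) =
      S ω * ((O' ω)ᵀ * O' ω) * (S ω)ᵀ := by
    calc _ = (O' ω * (S ω)⁻¹ * (S ω * (S ω)ᵀ))ᵀ * (O' ω * (S ω)⁻¹ * (S ω * (S ω)ᵀ)) := by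
          simp only [transpose_mul, transpose_transpose, Matrix.mul_assoc]
      _ = _ := by rw [hcancel]; simp only [transpose_mul, transpose_transpose, Matrix.mul_assoc]
  beta_reduce
  rw [Matrix.mul_sub, Matrix.sub_mul, hgram]
  abel

theorem transpose_mul_self_sub_one (hS : IsFactorTransform l g O O' R R' S)
    (hg : Tendsto g l (𝓝 0)) (hLO : ∀ ω, L ω * O ω = 1) (hL : L =O[l] fun _ => (1 : ℝ))
    (hO : O =O[l] fun _ => (1 : ℝ)) (hR : R =O[l] fun _ => (1 : ℝ))
    (hbal : ∀ ω, (O ω)ᵀ * O ω = R ω * (R ω)ᵀ) (hbal' : ∀ ω, (O' ω)ᵀ * O' ω = R' ω * (R' ω)ᵀ) :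
    (fun ω => (S ω)ᵀ * S ω - 1) =O[l] g := by
  have hmul_transpose : (fun ω => S ω * (S ω)ᵀ - 1) =O[l] g := by
    refine (IsBigO.of_norm_le fun ω => norm_gram_sub_one_le (hLO ω) (S ω)).trans ?_
    simpa using (hL.norm_left.pow 4).mul (isBigO_matrix_mul_of_bounded_left
      (isBigO_matrix_mul_of_bounded_left (isBigO_matrix_transpose hO) hO)
      (hS.gram_mul_gram_mul_gram_sub hg hO hR hbal hbal')).norm_left
  refine (isBigO_matrix_mul_of_bounded_right (isBigO_matrix_mul_of_bounded_left hS.bounded_inv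
    hmul_transpose) hS.bounded).congr' (hS.eventually_isUnit_det.mono fun ω h => ?_) .rfl
  simp only [Matrix.mul_sub, Matrix.sub_mul, Matrix.mul_one, nonsing_inv_mul _ h,
    nonsing_inv_mul_cancel_left _ _ h]

end IsFactorTransform

end BalancedFactors

section LeftInverse

open Asymptotics

variable {ι : Type} [Fintype ι] {n : ℕ}

theorem leftInv_mul_inv (X : Matrix ι (Fin n) ℝ) {T : Matrix (Fin n) (Fin n) ℝ}
    (hT : IsUnit T.det) : leftInv (X * T⁻¹) = T * leftInv X := by
  have hTt : IsUnit Tᵀ.det := by rwa [det_transpose]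
  calc leftInv (X * T⁻¹) = ((Tᵀ)⁻¹ * (Xᵀ * X) * T⁻¹)⁻¹ * ((Tᵀ)⁻¹ * Xᵀ) := by
        simp only [leftInv, transpose_mul, transpose_nonsing_inv, Matrix.mul_assoc]
    _ = T * (Xᵀ * X)⁻¹ * (Tᵀ * ((Tᵀ)⁻¹ * Xᵀ)) := by
        rw [Matrix.mul_inv_rev, Matrix.mul_inv_rev, nonsing_inv_nonsing_inv _ hT,
          nonsing_inv_nonsing_inv _ hTt]
        simp only [Matrix.mul_assoc]
    _ = T * leftInv X := by
        rw [mul_nonsing_inv_cancel_left _ _ hTt, Matrix.mul_assoc, leftInv]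

theorem isUnit_det_gram_of_injective {X : Matrix ι (Fin n) ℝ} (hX : Function.Injective X.mulVec) :
    IsUnit (Xᵀ * X).det := by
  rw [← conjTranspose_eq_transpose_of_trivial]
  exact (isUnit_iff_isUnit_det _).1 (PosDef.conjTranspose_mul_self X hX).isUnit

theorem leftInv_mul_self_of_injective {X : Matrix ι (Fin n) ℝ}
    (hX : Function.Injective X.mulVec) : leftInv X * X = 1 := by
  rw [leftInv, Matrix.mul_assoc]
  exact nonsing_inv_mul _ (isUnit_det_gram_of_injective hX)

theorem isBigO_leftInv_sub_leftInv {Ω : Type*} {l : Filter Ω} {g : Ω → ℝ}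
    {X X' : Ω → Matrix ι (Fin n) ℝ} (hg : Tendsto g l (𝓝 0)) (hX : X =O[l] fun _ => (1 : ℝ))
    (hunit : ∀ᶠ ω in l, IsUnit ((X ω)ᵀ * X ω).det)
    (hinv : (fun ω => ((X ω)ᵀ * X ω)⁻¹) =O[l] fun _ => (1 : ℝ))
    (hsub : (fun ω => X' ω - X ω) =O[l] g) :
    (fun ω => leftInv (X' ω) - leftInv (X ω)) =O[l] g := by
  have hgram := isBigO_matrix_inv_sub_inv hg hunit hinv (isBigO_gram_sub_gram hg hX hsub)
  exact isBigO_matrix_mul_sub_mul (isBigO_one_of_sub hg hinv hgram) (isBigO_matrix_transpose hX)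
    hgram (by simpa only [transpose_sub] using isBigO_matrix_transpose hsub)

end LeftInverse

section LowRank

variable {ν : Type*} [Fintype ν] [DecidableEq ν]

theorem frobenius_norm_diagonal_mul_le {κ : Type*} [Fintype κ] {d : ν → ℝ} {c : ℝ} (hc : 0 ≤ c)
    (hd : ∀ i, |d i| ≤ c) (A : Matrix ν κ ℝ) : ‖diagonal d * A‖ ≤ c * ‖A‖ := by
  refine le_of_sq_le_sq ?_ (by positivity)
  rw [mul_pow, frobenius_norm_sq, frobenius_norm_sq, Finset.mul_sum]
  simp only [Finset.mul_sum, diagonal_mul, norm_mul, mul_pow]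
  gcongr with i _ j _
  exact hd i

theorem le_norm_diagonal_sub_of_rank_lt {d : ν → ℝ} {c : ℝ} (hd : ∀ i, c ≤ d i)
    {B : Matrix ν ν ℝ} (hB : B.rank < Fintype.card ν) : c ≤ ‖diagonal d - B‖ := by
  by_contra! hlt
  have hc : 0 < c := (norm_nonneg _).trans_lt hlt
  have hpos (i : ν) : 0 < d i := hc.trans_le (hd i)
  have hinv : (diagonal fun i => (d i)⁻¹) * diagonal d = 1 := by
    simp [diagonal_mul_diagonal, inv_mul_cancel₀ (hpos _).ne']
  have hnear : ‖(diagonal fun i => (d i)⁻¹) * B - 1‖ < 1 := by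
    calc ‖(diagonal fun i => (d i)⁻¹) * B - 1‖
        = ‖(diagonal fun i => (d i)⁻¹) * (diagonal d - B)‖ := by
          rw [Matrix.mul_sub, hinv, norm_sub_rev]
      _ ≤ c⁻¹ * ‖diagonal d - B‖ := frobenius_norm_diagonal_mul_le (inv_nonneg.2 hc.le)
          (fun i => by rw [abs_of_pos (inv_pos.2 (hpos i))]; gcongr; exact hd i) _
      _ < 1 := by rwa [inv_mul_lt_iff₀ hc, mul_one]
  have hrank := rank_of_isUnit _
    ((isUnit_iff_isUnit_det _).2 (isUnit_det_of_norm_sub_one_lt_one hnear))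
  exact hB.not_ge (hrank ▸ rank_mul_le_right _ _)

theorem le_norm_sub_of_rank_lt {ι κ α β : Type*} [Fintype ι] [Fintype κ] [Fintype α] [Fintype β]
    [DecidableEq ι] [DecidableEq κ] [DecidableEq α] [DecidableEq β] {Q : Matrix ι α ℝ}
    {Q' : Matrix κ β ℝ} (hQ : Qᵀ * Q = 1) (hQ₂ : Q * Qᵀ = 1) (hQ' : Q'ᵀ * Q' = 1)
    (hQ'₂ : Q' * Q'ᵀ = 1) {M : Matrix α β ℝ} {f : ν → α} {g : ν → β} (hf : f.Injective)
    (hg : g.Injective) {d : ν → ℝ} (hM : M.submatrix f g = diagonal d) {c : ℝ}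
    (hd : ∀ i, c ≤ d i) {B : Matrix ι κ ℝ} (hB : B.rank < Fintype.card ν) :
    c ≤ ‖Q * M * Q'ᵀ - B‖ := by
  have hrank : ((Qᵀ * B * Q').submatrix f g).rank < Fintype.card ν := by
    refine lt_of_le_of_lt ?_ hB
    calc ((Qᵀ * B * Q').submatrix f g).rank
        = ((Q.submatrix id f)ᵀ * B * Q'.submatrix id g).rank := rfl
      _ ≤ B.rank := (rank_mul_le_left _ _).trans (rank_mul_le_right _ _)
  have hconj : Qᵀ * (Q * M * Q'ᵀ - B) * Q' = M - Qᵀ * B * Q' := by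
    calc Qᵀ * (Q * M * Q'ᵀ - B) * Q' = Qᵀ * Q * M * (Q'ᵀ * Q') - Qᵀ * B * Q' := by
          simp only [Matrix.mul_sub, Matrix.sub_mul, Matrix.mul_assoc]
      _ = _ := by rw [hQ, hQ', Matrix.one_mul, Matrix.mul_one]
  calc c ≤ ‖diagonal d - (Qᵀ * B * Q').submatrix f g‖ := le_norm_diagonal_sub_of_rank_lt hd hrank
    _ = ‖(Qᵀ * (Q * M * Q'ᵀ - B) * Q').submatrix f g‖ := by rw [hconj, ← hM]; rfl
    _ ≤ ‖Qᵀ * (Q * M * Q'ᵀ - B) * Q'‖ := frobenius_norm_submatrix_le _ hf hg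
    _ = ‖Q * M * Q'ᵀ - B‖ := by
        rw [← transpose_transpose Q', frobenius_norm_mul_isometry_transpose (by simpa using hQ'₂),
          frobenius_norm_isometry_mul (by simpa using hQ₂), transpose_transpose]

theorem card_eq_of_transpose_mul_self_eq_one {ι α : Type*} [Fintype ι] [Fintype α]
    [DecidableEq ι] [DecidableEq α] {Q : Matrix ι α ℝ} (hQ : Qᵀ * Q = 1) (hQ₂ : Q * Qᵀ = 1) :
    Fintype.card α = Fintype.card ι := by
  have h := trace_mul_comm Qᵀ Q
  rw [hQ, hQ₂, trace_one, trace_one] at h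
  exact_mod_cast h

theorem transpose_mul_of_fromCols_isometry {ι α β : Type*} [Fintype ι]
    [DecidableEq α] [DecidableEq β] {U : Matrix ι α ℝ} {Ue : Matrix ι β ℝ}
    (h : (fromCols U Ue)ᵀ * fromCols U Ue = 1) :
    Uᵀ * U = 1 ∧ Uᵀ * Ue = 0 ∧ Ueᵀ * Ue = 1 := by
  rw [transpose_fromCols, fromRows_mul_fromCols, ← fromBlocks_one, fromBlocks_inj] at h
  exact ⟨h.1, h.2.1, h.2.2.2⟩

end LowRank

section SingularValues

variable {ι κ : Type} [Fintype ι] [Fintype κ] [DecidableEq ι] [DecidableEq κ] {n : ℕ}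
  {H : Matrix ι κ ℝ} {U : Matrix ι (Fin n) ℝ} {s : Fin n → ℝ} {V : Matrix κ (Fin n) ℝ}

namespace IsLeadingSVD

theorem transpose_mul_left (h : IsLeadingSVD H U s V) : Uᵀ * U = 1 := by
  obtain ⟨a, b, Ue, Ve, t, hU, -⟩ := h
  exact (transpose_mul_of_fromCols_isometry hU).1

theorem transpose_mul_right (h : IsLeadingSVD H U s V) : Vᵀ * V = 1 := by
  obtain ⟨a, b, Ue, Ve, t, -, -, hV, -⟩ := h
  exact (transpose_mul_of_fromCols_isometry hV).1

theorem nonneg (h : IsLeadingSVD H U s V) (i : Fin n) : 0 ≤ s i := by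
  obtain ⟨a, b, Ue, Ve, t, -, -, -, -, -, -, hts, ht, -⟩ := h
  exact (ht 0).trans (hts i 0)

theorem transpose_mul_mul (h : IsLeadingSVD H U s V) : Uᵀ * H * V = diagonal s := by
  obtain ⟨a, b, Ue, Ve, t, hU, -, hV, -, -, -, -, -, rfl⟩ := h
  obtain ⟨hUU, hUUe, -⟩ := transpose_mul_of_fromCols_isometry hU
  obtain ⟨hVV, hVVe, -⟩ := transpose_mul_of_fromCols_isometry hV
  have hUQ : Uᵀ * fromCols U Ue = fromCols 1 0 := by rw [mul_fromCols, hUU, hUUe]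
  have hVQ : (fromCols V Ve)ᵀ * V = fromRows 1 0 := by
    rw [← transpose_inj, transpose_mul, transpose_transpose, mul_fromCols, hVV, hVVe]
    simp [transpose_fromRows]
  rw [← Matrix.mul_assoc, ← Matrix.mul_assoc, hUQ, Matrix.mul_assoc _ _ V, hVQ]
  simp [fromCols_mul_fromBlocks, fromCols_mul_fromRows]

theorem norm_sub_le (h : IsLeadingSVD H U s V) {B : Matrix ι κ ℝ} (hB : B.rank ≤ n) :
    ‖H - U * diagonal s * Vᵀ‖ ≤ √(Fintype.card ι * Fintype.card κ) * ‖H - B‖ := by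
  obtain ⟨a, b, Ue, Ve, t, hU, hU₂, hV, hV₂, -, -, hts, ht, rfl⟩ := h
  set E : Matrix (Fin a) (Fin b) ℝ := Matrix.of fun i j => if (i : ℕ) = j then t i else 0 with hE
  set H := fromCols U Ue * fromBlocks (diagonal s) 0 0 E * (fromCols V Ve)ᵀ with hH
  have hresidual : H - U * diagonal s * Vᵀ = Ue * E * Veᵀ := by
    simp [hH, transpose_fromCols, fromCols_mul_fromBlocks, fromCols_mul_fromRows]
  have hdiscarded (i : Fin a) (j : Fin b) (hij : (i : ℕ) = j) : t i ≤ ‖H - B‖ := by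
    refine le_norm_sub_of_rank_lt (ν := Fin n ⊕ Unit) (f := Sum.map id fun _ => i)
      (g := Sum.map id fun _ => j) (d := Sum.elim s fun _ => t i) hU hU₂ hV hV₂ ?_ ?_ ?_ ?_ ?_
    · exact Sum.map_injective.2 ⟨Function.injective_id, Function.injective_of_subsingleton _⟩
    · exact Sum.map_injective.2 ⟨Function.injective_id, Function.injective_of_subsingleton _⟩
    · ext (_ | _) (_ | _) <;> simp [hE, hij, diagonal_apply]
    · rintro (k | _)
      exacts [hts k i, le_rfl]
    · simpa using Nat.lt_succ_of_le hB
  have hentry (i : Fin a) (j : Fin b) : ‖E i j‖ ≤ ‖H - B‖ := by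
    by_cases hij : (i : ℕ) = j
    · simpa [hE, hij, abs_of_nonneg (ht _)] using hdiscarded i j hij
    · simp [hE, hij]
  have ha : n + a = Fintype.card ι := by
    simpa using card_eq_of_transpose_mul_self_eq_one hU hU₂
  have hb : n + b = Fintype.card κ := by
    simpa using card_eq_of_transpose_mul_self_eq_one hV hV₂
  calc ‖H - U * diagonal s * Vᵀ‖ = ‖E‖ := by
        rw [hresidual, frobenius_norm_mul_isometry_transpose
          (transpose_mul_of_fromCols_isometry hV).2.2, frobenius_norm_isometry_mul
          (transpose_mul_of_fromCols_isometry hU).2.2]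
    _ ≤ √(Fintype.card (Fin a) * Fintype.card (Fin b)) * ‖H - B‖ :=
        frobenius_norm_le_of_forall_norm_le (norm_nonneg _) hentry
    _ ≤ √(Fintype.card ι * Fintype.card κ) * ‖H - B‖ := by
        simp only [Fintype.card_fin]
        gcongr <;> omega

end IsLeadingSVD

/-- A factorization `O * R` of the best rank-`n` approximation of `H` read off a singular value
decomposition, with the singular values split evenly: `O = U Σ^{1/2}` and `R = Σ^{1/2} Vᵀ`. -/
def IsLeadingFactorization (H : Matrix ι κ ℝ) (O : Matrix ι (Fin n) ℝ) (R : Matrix (Fin n) κ ℝ) :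
    Prop :=
  ∃ (U : Matrix ι (Fin n) ℝ) (s : Fin n → ℝ) (V : Matrix κ (Fin n) ℝ), IsLeadingSVD H U s V ∧
    O = U * diagonal (fun i => √(s i)) ∧ R = diagonal (fun i => √(s i)) * Vᵀ

namespace IsLeadingFactorization

variable {O : Matrix ι (Fin n) ℝ} {R : Matrix (Fin n) κ ℝ}

theorem norm_sub_mul_le (h : IsLeadingFactorization H O R) {B : Matrix ι κ ℝ} (hB : B.rank ≤ n) :
    ‖H - O * R‖ ≤ √(Fintype.card ι * Fintype.card κ) * ‖H - B‖ := by
  obtain ⟨U, s, V, hsvd, rfl, rfl⟩ := h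
  have hOR : U * diagonal (fun i => √(s i)) * (diagonal (fun i => √(s i)) * Vᵀ) =
      U * diagonal s * Vᵀ := by
    rw [Matrix.mul_assoc, ← Matrix.mul_assoc (diagonal _), diagonal_mul_diagonal, Matrix.mul_assoc]
    simp only [Real.mul_self_sqrt (hsvd.nonneg _)]
  exact hOR ▸ hsvd.norm_sub_le hB

theorem mul_eq (h : IsLeadingFactorization H O R) (hH : H.rank ≤ n) : O * R = H := by
  simpa [sub_eq_zero, eq_comm] using h.norm_sub_mul_le hH

theorem gram_eq (h : IsLeadingFactorization H O R) : Oᵀ * O = R * Rᵀ := by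
  obtain ⟨U, s, V, hsvd, rfl, rfl⟩ := h
  calc (U * diagonal (fun i => √(s i)))ᵀ * (U * diagonal fun i => √(s i))
      = diagonal (fun i => √(s i)) * (Uᵀ * U) * diagonal fun i => √(s i) := by
        simp only [transpose_mul, diagonal_transpose, Matrix.mul_assoc]
    _ = diagonal (fun i => √(s i)) * (Vᵀ * V) * diagonal fun i => √(s i) := by
        rw [hsvd.transpose_mul_left, hsvd.transpose_mul_right]
    _ = _ := by
        simp only [transpose_mul, transpose_transpose, diagonal_transpose, Matrix.mul_assoc]

theorem norm_left_sq_le (h : IsLeadingFactorization H O R) : ‖O‖ ^ 2 ≤ n * ‖H‖ := by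
  obtain ⟨U, s, V, hsvd, rfl, -⟩ := h
  have hUV : ‖V * Uᵀ‖ ^ 2 = n := by
    rw [frobenius_norm_mul_isometry_transpose hsvd.transpose_mul_left,
      frobenius_norm_sq_isometry hsvd.transpose_mul_right, Fintype.card_fin]
  rw [frobenius_norm_isometry_mul hsvd.transpose_mul_left]
  calc ‖diagonal fun i => √(s i)‖ ^ 2 = trace (diagonal s) := by
        rw [frobenius_norm_sq_eq_trace, diagonal_transpose, diagonal_mul_diagonal]
        simp only [Real.mul_self_sqrt (hsvd.nonneg _)]
    _ = trace (H * (V * Uᵀ)) := by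
        rw [← hsvd.transpose_mul_mul, Matrix.mul_assoc, trace_mul_comm, Matrix.mul_assoc]
    _ ≤ ‖H‖ * ‖V * Uᵀ‖ := (le_abs_self _).trans (abs_trace_mul_le _ _)
    _ ≤ ‖H‖ * n := by
        gcongr
        refine le_of_sq_le_sq ?_ n.cast_nonneg
        rw [hUV]
        exact_mod_cast Nat.le_self_pow two_ne_zero n
    _ = n * ‖H‖ := mul_comm _ _

theorem norm_right_eq (h : IsLeadingFactorization H O R) : ‖R‖ = ‖O‖ := by
  rw [← sq_eq_sq₀ (norm_nonneg _) (norm_nonneg _), frobenius_norm_sq_eq_trace, ← h.gram_eq,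
    trace_mul_comm, ← frobenius_norm_sq_eq_trace]

end IsLeadingFactorization

end SingularValues

namespace StateSpace

section Minimality

variable {n m p d : ℕ}

theorem mcmillanDegree_le {P : StateSpace n m p} (Q : StateSpace d m p)
    (h : ∀ t, Q.impulse t = P.impulse t) : P.mcmillanDegree ≤ d :=
  Nat.sInf_le ⟨Q, h⟩

theorem impulse_eq_of_intertwine {P : StateSpace n m p} {Q : StateSpace d m p}
    (π : Matrix (Fin d) (Fin n) ℝ) (hA : Q.A * π = π * P.A) (hB : Q.B = π * P.B)
    (hC : Q.C * π = P.C) (hD : Q.D = P.D) (t : ℕ) : Q.impulse t = P.impulse t := by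
  have hpow : ∀ t : ℕ, Q.A ^ t * π = π * P.A ^ t := by
    intro t
    induction t with
    | zero => rw [pow_zero, pow_zero, Matrix.one_mul, Matrix.mul_one]
    | succ t ih =>
      rw [pow_succ, Matrix.mul_assoc, hA, ← Matrix.mul_assoc, ih, Matrix.mul_assoc, ← pow_succ]
  cases t with
  | zero => exact hD
  | succ t =>
    calc Q.C * Q.A ^ t * Q.B = Q.C * (Q.A ^ t * π) * P.B := by simp only [hB, Matrix.mul_assoc]
      _ = Q.C * π * P.A ^ t * P.B := by rw [hpow, Matrix.mul_assoc Q.C π]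
      _ = P.C * P.A ^ t * P.B := by rw [hC]

theorem mcmillanDegree_le_finrank_quotient (P : StateSpace n m p)
    (W : Submodule ℝ (Fin n → ℝ)) (hA : ∀ x ∈ W, P.A *ᵥ x ∈ W) (hC : ∀ x ∈ W, P.C *ᵥ x = 0) :
    P.mcmillanDegree ≤ Module.finrank ℝ ((Fin n → ℝ) ⧸ W) := by
  have hA' : W ≤ W.comap P.A.toLin' := hA
  have hC' : W ≤ LinearMap.ker P.C.toLin' := hC
  let e := (Module.finBasis ℝ ((Fin n → ℝ) ⧸ W)).equivFun
  let π := LinearMap.toMatrix' (e.toLinearMap ∘ₗ W.mkQ)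
  let Q : StateSpace _ m p :=
    { A := LinearMap.toMatrix' (e.toLinearMap ∘ₗ W.mapQ W P.A.toLin' hA' ∘ₗ e.symm.toLinearMap)
      B := π * P.B
      C := LinearMap.toMatrix' (W.liftQ P.C.toLin' hC' ∘ₗ e.symm.toLinearMap)
      D := P.D }
  refine mcmillanDegree_le Q (impulse_eq_of_intertwine π ?_ rfl ?_ rfl)
  · refine Matrix.toLin'.injective (LinearMap.ext fun x => ?_)
    simp [Q, π, Matrix.toLin'_mul]
  · refine Matrix.toLin'.injective (LinearMap.ext fun x => ?_)
    simp [Q, π, Matrix.toLin'_mul]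

/-- The unobservable subspace `⋂ i, ker (C Aⁱ)`: the states that produce no output. -/
def unobservable (P : StateSpace n m p) : Submodule ℝ (Fin n → ℝ) :=
  ⨅ i : ℕ, LinearMap.ker (P.C * P.A ^ i).mulVecLin

theorem mem_unobservable {P : StateSpace n m p} {x : Fin n → ℝ} :
    x ∈ P.unobservable ↔ ∀ i : ℕ, (P.C * P.A ^ i) *ᵥ x = 0 := by
  simp only [unobservable, Submodule.mem_iInf, LinearMap.mem_ker, Matrix.mulVecLin_apply]

theorem unobservable_eq_bot {P : StateSpace n m p} (h : P.mcmillanDegree = n) :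
    P.unobservable = ⊥ := by
  have hle := P.mcmillanDegree_le_finrank_quotient P.unobservable
    (fun x hx => mem_unobservable.2 fun i => by
      rw [Matrix.mulVec_mulVec, Matrix.mul_assoc, ← pow_succ]
      exact mem_unobservable.1 hx (i + 1))
    (fun x hx => by simpa only [pow_zero, Matrix.mul_one] using mem_unobservable.1 hx 0)
  have hfinrank := P.unobservable.finrank_quotient_add_finrank
  rw [Module.finrank_fin_fun] at hfinrank
  exact Submodule.finrank_eq_zero.1 (by omega)

theorem mem_unobservable_of_forall_lt (P : StateSpace n m p) {x : Fin n → ℝ}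
    (hx : ∀ i < n, (P.C * P.A ^ i) *ᵥ x = 0) : x ∈ P.unobservable := by
  refine mem_unobservable.2 fun i => ?_
  rcases n.eq_zero_or_pos with rfl | hn
  · rw [Subsingleton.elim x 0, Matrix.mulVec_zero]
  have : Nonempty (Fin n) := ⟨⟨0, hn⟩⟩
  have hdeg : (Polynomial.X ^ i %ₘ P.A.charpoly).natDegree < n := by
    have hcard : P.A.charpoly.natDegree = n :=
      P.A.charpoly_natDegree_eq_dim.trans (Fintype.card_fin n)
    refine (Polynomial.natDegree_modByMonic_lt _ P.A.charpoly_monic fun h => ?_).trans_eq hcard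
    rw [h, Polynomial.natDegree_one] at hcard
    exact hn.ne hcard
  rw [Matrix.pow_eq_aeval_mod_charpoly, Polynomial.aeval_eq_sum_range' hdeg, Matrix.mul_sum,
    Matrix.sum_mulVec]
  refine Finset.sum_eq_zero fun j hj => ?_
  rw [Matrix.mul_smul, Matrix.smul_mulVec, hx j (Finset.mem_range.1 hj), smul_zero]

theorem eq_zero_of_forall_lt {P : StateSpace n m p} (h : P.mcmillanDegree = n)
    {x : Fin n → ℝ} (hx : ∀ i < n, (P.C * P.A ^ i) *ᵥ x = 0) : x = 0 := by
  have hmem := P.mem_unobservable_of_forall_lt hx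
  rwa [unobservable_eq_bot h, Submodule.mem_bot] at hmem

theorem eq_zero_of_pow_mulVec_eq_zero {P : StateSpace n m p} (h : P.mcmillanDegree = n)
    {x : Fin n → ℝ} {t : ℕ} (hx : ∀ i < t, (P.C * P.A ^ i) *ᵥ x = 0)
    (ht : P.A ^ t *ᵥ x = 0) : x = 0 := by
  refine eq_zero_of_forall_lt h fun i _ => ?_
  rcases lt_or_ge i t with hi | hi
  · exact hx i hi
  · obtain ⟨j, rfl⟩ := Nat.exists_eq_add_of_le' hi
    rw [pow_add, ← Matrix.mul_assoc, ← Matrix.mulVec_mulVec, ht, Matrix.mulVec_zero]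

/-- The dual quadruple `(Aᵀ, Cᵀ, Bᵀ, Dᵀ)`, which exchanges observability and controllability. -/
def dual (P : StateSpace n m p) : StateSpace n p m :=
  ⟨P.Aᵀ, P.Cᵀ, P.Bᵀ, P.Dᵀ⟩

theorem impulse_dual (P : StateSpace n m p) (t : ℕ) : P.dual.impulse t = (P.impulse t)ᵀ := by
  cases t with
  | zero => rfl
  | succ t => simp only [impulse, dual, transpose_mul, transpose_pow, Matrix.mul_assoc]

theorem mcmillanDegree_dual_le (P : StateSpace n m p) :
    P.dual.mcmillanDegree ≤ P.mcmillanDegree := by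
  obtain ⟨Q, hQ⟩ : ∃ Q : StateSpace P.mcmillanDegree m p, ∀ t, Q.impulse t = P.impulse t :=
    Nat.sInf_mem (s := {d | ∃ Q : StateSpace d m p, ∀ t, Q.impulse t = P.impulse t})
      ⟨n, P, fun _ => rfl⟩
  exact mcmillanDegree_le Q.dual fun t => by rw [impulse_dual, impulse_dual, hQ]

theorem mcmillanDegree_dual (P : StateSpace n m p) : P.dual.mcmillanDegree = P.mcmillanDegree :=
  P.mcmillanDegree_dual_le.antisymm P.dual.mcmillanDegree_dual_le

end Minimality

end StateSpace

section Dwell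

variable {σ N d : ℕ} {φ : ℕ → Fin σ}

theorem MinDwellAtLeast.add_le (h : MinDwellAtLeast N φ d) {k l : ℕ} (hk : IsSwitch N φ k)
    (hl : IsSwitch N φ l) (hkl : k < l) : k + d ≤ l := by
  classical
  have hex : ∃ j, k < j ∧ IsSwitch N φ j := ⟨l, hkl, hl⟩
  obtain ⟨hlt, hswitch⟩ := Nat.find_spec hex
  have hnext := h k (Nat.find hex) hk hswitch hlt fun j hj hj' hs => Nat.find_min hex hj' ⟨hj, hs⟩
  exact hnext.trans (Nat.find_min' hex ⟨hkl, hl⟩)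

theorem MinDwellAtLeast.reverse (h : MinDwellAtLeast N φ d) :
    MinDwellAtLeast N (fun k => φ (N + 1 - k)) d := by
  have hreverse : ∀ s, IsSwitch N (fun k => φ (N + 1 - k)) s → IsSwitch N φ (N + 2 - s) := by
    rintro s ⟨hs, hsN, hne⟩
    refine ⟨by omega, by omega, fun heq => hne ?_⟩
    rw [show N + 2 - s - 1 = N + 1 - s by omega] at heq
    exact heq.symm.trans (congrArg φ (by omega))
  intro k l hk hl hkl _
  have hle := h.add_le (hreverse l hl) (hreverse k hk) (by have := hl.2.1; omega)
  have := hk.2.1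
  omega

theorem eq_of_forall_not_isSwitch {a b : ℕ} (ha : 1 ≤ a) (hb : b ≤ N)
    (h : ∀ s, a < s → s ≤ b → ¬ IsSwitch N φ s) {j : ℕ} (haj : a ≤ j) (hjb : j ≤ b) :
    φ j = φ a := by
  induction j, haj using Nat.le_induction with
  | base => rfl
  | succ j haj ih =>
    rw [← ih (by omega)]
    by_contra hne
    exact h (j + 1) (by omega) hjb ⟨by omega, by omega, by simpa only [add_tsub_cancel_right]⟩

theorem MinDwellAtLeast.exists_segments (h : MinDwellAtLeast N φ d) {k : ℕ} (hk : 1 ≤ k)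
    (hN : k + 2 * d ≤ N + 1) :
    ∃ t ≤ d, (∀ i < t, φ (k + i) = φ k) ∧ (t < d → ∀ i < d, φ (k + t + i) = φ (k + t)) := by
  by_cases hs : ∃ s, k < s ∧ s < k + d ∧ IsSwitch N φ s
  · obtain ⟨s, hks, hsd, hsw⟩ := hs
    refine ⟨s - k, by omega, fun i hi => ?_, fun _ i hi => ?_⟩
    · refine eq_of_forall_not_isSwitch (N := N) (b := s - 1) hk (by omega) (fun l _ _ hlw => ?_)
        (by omega) (by omega)
      have := h.add_le hlw hsw (by omega)
      omega
    · rw [show k + (s - k) = s by omega]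
      refine eq_of_forall_not_isSwitch (N := N) (b := s + d - 1) (by omega) (by omega)
        (fun l _ _ hlw => ?_) (by omega) (by omega)
      have := h.add_le hsw hlw (by omega)
      omega
  · refine ⟨d, le_rfl, fun i hi => ?_, fun hd => absurd hd (lt_irrefl d)⟩
    exact eq_of_forall_not_isSwitch (N := N) (b := k + d - 1) hk (by omega)
      (fun l hl _ hlw => hs ⟨l, hl, by omega, hlw⟩) (by omega) (by omega)

end Dwell

section TimeVarying

variable {n m p : ℕ}

/-- The observability matrix with block rows `C (k+i) A (k+i-1) ⋯ A k`, `0 ≤ i < q`. -/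
noncomputable def obsMatrix (P : ℕ → StateSpace n m p) (k q : ℕ) :
    Matrix (Fin q × Fin p) (Fin n) ℝ :=
  Matrix.of fun i j => ((P (k + i.1)).C * transitionAux P k i.1) i.2 j

/-- The controllability matrix with block columns `A (k-1) ⋯ A (k-j) B (k-1-j)`, `0 ≤ j < r`, of
the inputs that lead to the state at time `k`. -/
noncomputable def ctrlMatrix (P : ℕ → StateSpace n m p) (k r : ℕ) :
    Matrix (Fin n) (Fin r × Fin m) ℝ :=
  Matrix.of fun i j => (transitionAux P (k - j.1) j.1 * (P (k - 1 - j.1)).B) i j.2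

/-- The state at time `k` is determined by the free response over the times `k, …, k+q-1`. -/
def IsObservableAt (P : ℕ → StateSpace n m p) (k q : ℕ) : Prop :=
  Function.Injective (obsMatrix P k q).mulVec

/-- Every state at time `k` is reached from the origin by inputs at the times `k-r, …, k-1`. -/
def IsControllableAt (P : ℕ → StateSpace n m p) (k r : ℕ) : Prop :=
  Function.Surjective (ctrlMatrix P k r).mulVec

theorem transitionAux_add (P : ℕ → StateSpace n m p) (l s t : ℕ) :
    transitionAux P l (s + t) = transitionAux P (l + s) t * transitionAux P l s := by
  induction t with
  | zero => simp only [transitionAux, add_zero, Matrix.one_mul]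
  | succ t ih => rw [← add_assoc, transitionAux, ih, transitionAux, Matrix.mul_assoc, add_assoc]

theorem hankel_markov (P : ℕ → StateSpace n m p) {k q r : ℕ} (hk : r < k) :
    hankel q r (markov P) k = obsMatrix P k q * ctrlMatrix P k r := by
  ext ⟨i, a⟩ ⟨j, b⟩
  have hj := j.2
  have hlt : k - 1 - (j : ℕ) < k + i := by omega
  have hblock : markov P (k + i) (k - 1 - j) = (P (k + i)).C * transitionAux P k i *
      (transitionAux P (k - j) j * (P (k - 1 - j)).B) := by
    rw [markov, if_pos hlt, transition, show k - 1 - (j : ℕ) + 1 = k - j by omega,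
      show k + (i : ℕ) - (k - j) = j + i by omega, transitionAux_add,
      show k - (j : ℕ) + j = k by omega]
    simp only [Matrix.mul_assoc]
  exact congrFun (congrFun hblock a) b

theorem shiftDown_mul_obsMatrix (P : ℕ → StateSpace n m p) (k q : ℕ) :
    shiftDown q p * obsMatrix P k (q + 1) = obsMatrix P k q := by
  ext i j
  rw [Matrix.mul_apply, Finset.sum_eq_single (i.1.castSucc, i.2)]
  · simp [shiftDown, obsMatrix]
  · rintro ⟨a, b⟩ - hne
    have : ¬ (a = i.1.castSucc ∧ b = i.2) := fun h => hne (Prod.ext h.1 h.2)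
    simp [shiftDown, this]
  · simp

theorem IsObservableAt.injective_shiftDown_mul {P : ℕ → StateSpace n m p} {k q : ℕ}
    (h : IsObservableAt P k q) :
    Function.Injective (shiftDown q p * obsMatrix P k (q + 1)).mulVec := by
  rwa [shiftDown_mul_obsMatrix]

theorem IsObservableAt.succ {P : ℕ → StateSpace n m p} {k q : ℕ} (h : IsObservableAt P k q) :
    IsObservableAt P k (q + 1) :=
  .of_comp (f := (shiftDown q p).mulVec) <| by
    simpa only [Function.comp_def, mulVec_mulVec] using h.injective_shiftDown_mul

theorem isObservableAt_iff {P : ℕ → StateSpace n m p} {k q : ℕ} :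
    IsObservableAt P k q ↔
      ∀ x, (∀ i < q, ((P (k + i)).C * transitionAux P k i) *ᵥ x = 0) → x = 0 := by
  have hzero : ∀ x, obsMatrix P k q *ᵥ x = 0 ↔
      ∀ i < q, ((P (k + i)).C * transitionAux P k i) *ᵥ x = 0 := fun x =>
    ⟨fun h i hi => funext fun a => congrFun h (⟨i, hi⟩, a),
      fun h => funext fun i => congrFun (h i.1 i.1.2) i.2⟩
  simp only [← hzero]
  exact injective_iff_map_eq_zero (obsMatrix P k q).mulVecLin

/-- The system run backwards in time from `N` to `1`, with dual quadruples. Its observability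
matrices are the transposes of the controllability matrices of the original system. -/
def reversedDual (N : ℕ) (P : ℕ → StateSpace n m p) (k : ℕ) : StateSpace n p m :=
  (P (N + 1 - k)).dual

theorem transitionAux_reversedDual {N : ℕ} (P : ℕ → StateSpace n m p) {l t : ℕ}
    (h : l + t ≤ N + 1) :
    transitionAux (reversedDual N P) (N + 2 - (l + t)) t = (transitionAux P l t)ᵀ := by
  induction t generalizing l with
  | zero => exact transpose_one.symm
  | succ t ih =>
    have hlast : (reversedDual N P (N + 2 - (l + (t + 1)) + t)).A = (P l).Aᵀ := by
      rw [reversedDual, show N + 1 - (N + 2 - (l + (t + 1)) + t) = l by omega, StateSpace.dual]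
    have hfirst : transitionAux P l (t + 1) = transitionAux P (l + 1) t * (P l).A := by
      rw [add_comm t, transitionAux_add]
      simp only [transitionAux, add_zero, Matrix.mul_one]
    rw [transitionAux, hlast, hfirst, transpose_mul, ← ih (by omega),
      show l + 1 + t = l + (t + 1) by omega]

theorem obsMatrix_reversedDual {N : ℕ} (P : ℕ → StateSpace n m p) {k r : ℕ} (hr : r < k)
    (hk : k ≤ N + 1) :
    obsMatrix (reversedDual N P) (N + 2 - k) r = (ctrlMatrix P k r)ᵀ := by
  ext ⟨j, b⟩ a
  have hj := j.2
  have htransition := transitionAux_reversedDual (N := N) P (l := k - j) (t := j) (by omega)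
  rw [Nat.sub_add_cancel (by omega)] at htransition
  have hblock : (reversedDual N P (N + 2 - k + j)).C *
      transitionAux (reversedDual N P) (N + 2 - k) j =
        (transitionAux P (k - j) j * (P (k - 1 - j)).B)ᵀ := by
    rw [htransition, transpose_mul, reversedDual,
      show N + 1 - (N + 2 - k + (j : ℕ)) = k - 1 - j by omega, StateSpace.dual]
  exact congrFun (congrFun hblock b) a

theorem IsObservableAt.isControllableAt {N : ℕ} {P : ℕ → StateSpace n m p} {k r : ℕ}
    (hr : r < k) (hk : k ≤ N + 1) (h : IsObservableAt (reversedDual N P) (N + 2 - k) r) :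
    IsControllableAt P k r := by
  rw [IsObservableAt, obsMatrix_reversedDual P hr hk] at h
  refine Matrix.mulVec_surjective_iff_exists_right_inverse.2 ⟨(leftInv (ctrlMatrix P k r)ᵀ)ᵀ, ?_⟩
  rw [← transpose_inj, transpose_mul, transpose_transpose, leftInv_mul_self_of_injective h,
    transpose_one]

end TimeVarying

section Switched

variable {n m p σ N : ℕ} {modes : Fin σ → StateSpace n m p} {φ : ℕ → Fin σ}

theorem transitionAux_switchedSystem_of_eq {a t : ℕ} {c : Fin σ} (h : ∀ i < t, φ (a + i) = c) :
    transitionAux (switchedSystem modes φ) a t = (modes c).A ^ t := by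
  induction t with
  | zero => rfl
  | succ t ih =>
    rw [transitionAux, ih fun i hi => h i (by omega), pow_succ', switchedSystem, h t (by omega)]

/-- A window of `2n` times holds either `n` times of the first mode, or its first `t < n` times are
followed by `n` times of one mode: the latter determine the state after `t` steps, and then the
former determine the initial state. -/
theorem isObservableAt_switchedSystem (hdegree : ∀ j, (modes j).mcmillanDegree = n)
    (hdwell : MinDwellAtLeast N φ n) {k : ℕ} (hk : 1 ≤ k) (hN : k + 2 * n ≤ N + 1) :
    IsObservableAt (switchedSystem modes φ) k (2 * n) := by
  refine isObservableAt_iff.2 fun x hx => ?_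
  obtain ⟨t, htn, hfirst, hsecond⟩ := hdwell.exists_segments hk hN
  have hpow : ∀ i ≤ t, transitionAux (switchedSystem modes φ) k i = (modes (φ k)).A ^ i :=
    fun i hi => transitionAux_switchedSystem_of_eq fun l hl => hfirst l (by omega)
  have hobs : ∀ i < t, ((modes (φ k)).C * (modes (φ k)).A ^ i) *ᵥ x = 0 := by
    intro i hi
    have hxi := hx i (by omega)
    rwa [hpow i hi.le, switchedSystem, hfirst i hi] at hxi
  rcases htn.eq_or_lt with rfl | htn
  · exact StateSpace.eq_zero_of_forall_lt (hdegree _) hobs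
  · refine StateSpace.eq_zero_of_pow_mulVec_eq_zero (hdegree _) hobs
      (StateSpace.eq_zero_of_forall_lt (hdegree (φ (k + t))) fun i hi => ?_)
    have hxi := hx (t + i) (by omega)
    rwa [transitionAux_add, hpow t le_rfl, ← add_assoc, switchedSystem, hsecond htn i hi,
      transitionAux_switchedSystem_of_eq fun l hl => hsecond htn l (by omega),
      ← Matrix.mul_assoc, ← Matrix.mulVec_mulVec] at hxi

theorem isControllableAt_switchedSystem (hdegree : ∀ j, (modes j).mcmillanDegree = n)
    (hdwell : MinDwellAtLeast N φ n) {k : ℕ} (hk : 2 * n + 1 ≤ k) (hN : k ≤ N + 1) :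
    IsControllableAt (switchedSystem modes φ) k (2 * n) := by
  have hdual : ∀ j, (modes j).dual.mcmillanDegree = n := fun j =>
    (modes j).mcmillanDegree_dual.trans (hdegree j)
  exact IsObservableAt.isControllableAt hk hN
    (isObservableAt_switchedSystem hdual hdwell.reverse (by omega) (by omega))

end Switched

section FactorPerturbation

open Asymptotics

theorem rank_mul_le_width {ι κ : Type*} [Fintype κ] {n : ℕ} (X : Matrix ι (Fin n) ℝ)
    (Y : Matrix (Fin n) κ ℝ) : (X * Y).rank ≤ n :=
  (rank_mul_le_left X Y).trans ((rank_le_card_width X).trans_eq (Fintype.card_fin n))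

theorem mul_mul_eq_one_of_mul_eq {ι κ ν : Type*} [Fintype ι] [Fintype κ] [Fintype ν]
    [DecidableEq ν] {O O₀ : Matrix ι ν ℝ} {R R₀ : Matrix ν κ ℝ} {L₀ : Matrix ν ι ℝ}
    {G₀ : Matrix κ ν ℝ} (hLO : L₀ * O₀ = 1) (hRG : R₀ * G₀ = 1) (h : O * R = O₀ * R₀) :
    R * (G₀ * L₀) * O = 1 := by
  have hinv : L₀ * O * (R * G₀) = 1 :=
    calc L₀ * O * (R * G₀) = L₀ * (O * R) * G₀ := by simp only [Matrix.mul_assoc]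
      _ = L₀ * O₀ * (R₀ * G₀) := by rw [h]; simp only [Matrix.mul_assoc]
      _ = 1 := by rw [hLO, hRG, Matrix.one_mul]
  rw [← mul_eq_one_comm.1 hinv]
  simp only [Matrix.mul_assoc]

section Gram

variable {ι ν : Type*} [Fintype ι] [Fintype ν] [DecidableEq ν] {X X₀ : Matrix ι ν ℝ}
  {T : Matrix ν ν ℝ}

theorem isUnit_det_gram_of_mul_eq (h : X * T = X₀) (hX₀ : IsUnit (X₀ᵀ * X₀).det) :
    IsUnit (Xᵀ * X).det ∧ IsUnit T.det := by
  rw [← h, transpose_mul, Matrix.mul_assoc, ← Matrix.mul_assoc Xᵀ, det_mul, det_mul] at hX₀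
  exact IsUnit.mul_iff.1 (IsUnit.mul_iff.1 hX₀).2

theorem inv_gram_of_mul_eq (h : X * T = X₀) (hX₀ : IsUnit (X₀ᵀ * X₀).det) :
    (Xᵀ * X)⁻¹ = T * (X₀ᵀ * X₀)⁻¹ * Tᵀ := by
  have hT := (isUnit_det_gram_of_mul_eq h hX₀).2
  have hTt : IsUnit Tᵀ.det := by rwa [det_transpose]
  have hgram : X₀ᵀ * X₀ = Tᵀ * (Xᵀ * X * T) := by
    rw [← h, transpose_mul]
    simp only [Matrix.mul_assoc]
  rw [hgram, Matrix.mul_inv_rev, Matrix.mul_inv_rev, ← Matrix.mul_assoc, ← Matrix.mul_assoc,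
    mul_nonsing_inv _ hT, Matrix.one_mul, nonsing_inv_mul_cancel_right _ _ hTt]

end Gram

variable {Ω : Type*} {l : Filter Ω} {g : Ω → ℝ} {ι κ : Type} [Fintype ι] [Fintype κ]
  {n : ℕ} {O O' : Ω → Matrix ι (Fin n) ℝ} {R R' : Ω → Matrix (Fin n) κ ℝ}

theorem IsFactorTransform.isBigO_leftInv_mul_sub {α : Type} [Fintype α] {J J₁ : Matrix α ι ℝ}
    {O₁ O₁' : Ω → Matrix ι (Fin n) ℝ} {R₁ R₁' : Ω → Matrix (Fin n) κ ℝ}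
    {S S₁ : Ω → Matrix (Fin n) (Fin n) ℝ} (hg : Tendsto g l (𝓝 0))
    (hS : IsFactorTransform l g O O' R R' S) (hS₁ : IsFactorTransform l g O₁ O₁' R₁ R₁' S₁)
    (hO : O =O[l] fun _ => (1 : ℝ)) (hO₁ : O₁ =O[l] fun _ => (1 : ℝ))
    (hunit : ∀ ω, IsUnit ((J₁ * O₁ ω)ᵀ * (J₁ * O₁ ω)).det)
    (hinv : (fun ω => ((J₁ * O₁ ω)ᵀ * (J₁ * O₁ ω))⁻¹) =O[l] fun _ => (1 : ℝ)) :
    (fun ω => S₁ ω * (leftInv (J₁ * O₁' ω) * (J * O' ω)) * (S ω)⁻¹ -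
      leftInv (J₁ * O₁ ω) * (J * O ω)) =O[l] g := by
  have hmul : ∀ (K : Matrix α ι ℝ) {X : Ω → Matrix ι (Fin n) ℝ} {f : Ω → ℝ}, X =O[l] f →
      (fun ω => K * X ω) =O[l] f := fun K _ _ hX =>
    isBigO_matrix_mul_of_bounded_left (isBigO_const_one ℝ K l) hX
  have hsub : (fun ω => leftInv (J₁ * (O₁' ω * (S₁ ω)⁻¹)) - leftInv (J₁ * O₁ ω)) =O[l] g := by
    refine isBigO_leftInv_sub_leftInv hg (hmul J₁ hO₁) (.of_forall hunit) hinv ?_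
    simpa only [Matrix.mul_sub] using hmul J₁ hS₁.left_sub
  have hleft := isBigO_one_of_sub hg
    (isBigO_matrix_mul_of_bounded_left hinv (isBigO_matrix_transpose (hmul J₁ hO₁))) hsub
  have hprod := isBigO_matrix_mul_sub_mul hleft (hmul J hO) hsub
    (by simpa only [Matrix.mul_sub] using hmul J hS.left_sub)
  refine hprod.congr' ?_ .rfl
  filter_upwards [hS₁.eventually_isUnit_det] with ω hω
  rw [← Matrix.mul_assoc J₁, leftInv_mul_inv _ hω]
  simp only [Matrix.mul_assoc]

variable [DecidableEq ι] [DecidableEq κ] {H : Ω → Matrix ι κ ℝ} {O₀ : Matrix ι (Fin n) ℝ}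
  {R₀ : Matrix (Fin n) κ ℝ}

namespace IsLeadingFactorization

theorem isBigO_left (hOR : ∀ ω, IsLeadingFactorization (H ω) (O ω) (R ω))
    (hH : H =O[l] fun _ => (1 : ℝ)) : O =O[l] fun _ => (1 : ℝ) := by
  have hsq : (fun ω => ‖O ω‖ ^ 2) =O[l] H :=
    .of_bound n (.of_forall fun ω => by
      rw [Real.norm_of_nonneg (sq_nonneg _)]
      exact (hOR ω).norm_left_sq_le)
  refine (IsBigO.of_pow two_ne_zero ?_).of_norm_left
  simpa only [Pi.pow_def, one_pow] using hsq.trans hH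

theorem isBigO_right (hOR : ∀ ω, IsLeadingFactorization (H ω) (O ω) (R ω))
    (hH : H =O[l] fun _ => (1 : ℝ)) : R =O[l] fun _ => (1 : ℝ) :=
  (isBigO_of_le l fun ω => (hOR ω).norm_right_eq.le).trans (isBigO_left hOR hH)

theorem isBigO_mul_sub_mul (hOR : ∀ ω, IsLeadingFactorization (O₀ * R₀) (O ω) (R ω))
    (hOR' : ∀ ω, IsLeadingFactorization (H ω) (O' ω) (R' ω))
    (hH : (fun ω => H ω - O₀ * R₀) =O[l] g) : (fun ω => O' ω * R' ω - O ω * R ω) =O[l] g := by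
  have htrunc : (fun ω => H ω - O' ω * R' ω) =O[l] fun ω => H ω - O₀ * R₀ :=
    .of_bound _ (.of_forall fun ω => (hOR' ω).norm_sub_mul_le (rank_mul_le_width O₀ R₀))
  refine (hH.sub (htrunc.trans hH)).congr_left fun ω => ?_
  rw [(hOR ω).mul_eq (rank_mul_le_width O₀ R₀)]
  abel

theorem exists_isFactorTransform (hg : Tendsto g l (𝓝 0)) (hO₀ : Function.Injective O₀.mulVec)
    (hR₀ : Function.Surjective R₀.mulVec)
    (hOR : ∀ ω, IsLeadingFactorization (O₀ * R₀) (O ω) (R ω))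
    (hOR' : ∀ ω, IsLeadingFactorization (H ω) (O' ω) (R' ω))
    (hH : (fun ω => H ω - O₀ * R₀) =O[l] g) :
    ∃ S : Ω → Matrix (Fin n) (Fin n) ℝ, IsFactorTransform l g O O' R R' S ∧
      (fun ω => (S ω)ᵀ * S ω - 1) =O[l] g := by
  obtain ⟨G₀, hG₀⟩ := Matrix.mulVec_surjective_iff_exists_right_inverse.1 hR₀
  have hone : ∀ ω, R ω * (G₀ * leftInv O₀) * O ω = 1 := fun ω =>
    mul_mul_eq_one_of_mul_eq (leftInv_mul_self_of_injective hO₀) hG₀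
      ((hOR ω).mul_eq (rank_mul_le_width O₀ R₀))
  have hconst : (fun _ : Ω => O₀ * R₀) =O[l] fun _ => (1 : ℝ) := isBigO_const_one ℝ _ l
  have hmid : (fun _ : Ω => G₀ * leftInv O₀) =O[l] fun _ => (1 : ℝ) := isBigO_const_one ℝ _ l
  have hHone := isBigO_one_of_sub hg hconst hH
  have hO := isBigO_left hOR hconst
  have hR := isBigO_right hOR hconst
  have hL := isBigO_matrix_mul_of_bounded_left hR hmid
  have hS := isFactorTransform_of_product_sub (G := fun ω => G₀ * leftInv O₀ * O ω) hg hone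
    (fun ω => by rw [← Matrix.mul_assoc, hone]) hL (isBigO_matrix_mul_of_bounded_left hmid hO) hO
    (isBigO_left hOR' hHone) (isBigO_right hOR' hHone) (isBigO_mul_sub_mul hOR hOR' hH)
  exact ⟨_, hS, hS.transpose_mul_self_sub_one hg hone hL hO hR (fun ω => (hOR ω).gram_eq)
    fun ω => (hOR' ω).gram_eq⟩

theorem isUnit_det_gram_mul_left_and_isBigO_inv {α : Type} [Fintype α] {J : Matrix α ι ℝ}
    (hJ : Function.Injective (J * O₀).mulVec) (hR₀ : Function.Surjective R₀.mulVec)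
    (hOR : ∀ ω, IsLeadingFactorization (O₀ * R₀) (O ω) (R ω)) :
    (∀ ω, IsUnit ((J * O ω)ᵀ * (J * O ω)).det) ∧
      (fun ω => ((J * O ω)ᵀ * (J * O ω))⁻¹) =O[l] fun _ => (1 : ℝ) := by
  obtain ⟨G₀, hG₀⟩ := Matrix.mulVec_surjective_iff_exists_right_inverse.1 hR₀
  have hunit := isUnit_det_gram_of_injective hJ
  have hbasis : ∀ ω, J * O ω * (R ω * G₀) = J * O₀ := fun ω => by
    rw [Matrix.mul_assoc, ← Matrix.mul_assoc (O ω), (hOR ω).mul_eq (rank_mul_le_width O₀ R₀),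
      Matrix.mul_assoc, hG₀, Matrix.mul_one]
  have hT : (fun ω => R ω * G₀) =O[l] fun _ => (1 : ℝ) :=
    isBigO_matrix_mul_of_bounded_left (isBigO_right hOR (isBigO_const_one ℝ _ l))
      (isBigO_const_one ℝ _ l)
  refine ⟨fun ω => (isUnit_det_gram_of_mul_eq (hbasis ω) hunit).1, ?_⟩
  simp only [fun ω => inv_gram_of_mul_eq (hbasis ω) hunit]
  exact isBigO_matrix_mul_of_bounded_left
    (isBigO_matrix_mul_of_bounded_left hT (isBigO_const_one ℝ _ l)) (isBigO_matrix_transpose hT)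

end IsLeadingFactorization

end FactorPerturbation

section Runs

open Asymptotics

variable {n m p N : ℕ} {h : ℕ → ℕ → Matrix (Fin p) (Fin m) ℝ}

/-- The times whose Hankel matrices the algorithm factorizes. -/
def hankelTimes (n N : ℕ) : Set ℕ :=
  {j | ∃ k ∈ estimationTimes n N, j ∈ ({k, k + 1} : Set ℕ)}

theorem le_of_mem_hankelTimes {j : ℕ} (hj : j ∈ hankelTimes n N) :
    2 * n + 1 ≤ j ∧ j + 4 * n ≤ N + 1 := by
  obtain ⟨k, ⟨hlow, hup⟩, rfl | rfl⟩ := hj <;> constructor <;> omega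

theorem finite_estimationTimes (n N : ℕ) : (estimationTimes n N).Finite :=
  (Set.finite_Iic N).subset fun _ hk => (Nat.le_add_right _ _).trans hk.2

theorem finite_hankelTimes (n N : ℕ) : (hankelTimes n N).Finite :=
  (Set.finite_Iic (N + 1)).subset fun _ hj =>
    (Nat.le_add_right _ _).trans (le_of_mem_hankelTimes hj).2

theorem hankel_add (q r : ℕ) (h e : ℕ → ℕ → Matrix (Fin p) (Fin m) ℝ) (k : ℕ) :
    hankel q r (fun k l => h k l + e k l) k = hankel q r h k + hankel q r e k :=
  rfl

theorem NoiseBounded.norm_hankel_le {ε : ℝ} {e : ℕ → ℕ → Matrix (Fin p) (Fin m) ℝ}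
    (he : NoiseBounded n N ε e) {k : ℕ} (hk : k ∈ hankelTimes n N) :
    ‖hankel (2 * n + 1) (2 * n) e k‖ ≤
      √(Fintype.card (Fin (2 * n + 1) × Fin p) * Fintype.card (Fin (2 * n) × Fin m)) * |ε| := by
  obtain ⟨hlow, hup⟩ := le_of_mem_hankelTimes hk
  refine frobenius_norm_le_of_forall_norm_le (abs_nonneg ε) ?_
  rintro ⟨i, a⟩ ⟨j, b⟩
  have hi := i.2
  have hj := j.2
  calc ‖e (k + i) (k - 1 - j) a b‖ ≤ ‖e (k + i) (k - 1 - j)‖ := norm_entry_le_frobenius_norm ..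
    _ ≤ ε := he _ _ (by omega) (by omega) (by omega) (by omega)
    _ ≤ |ε| := le_abs_self ε

theorem IsAlgorithmOutput.exists_factors {Phat : ℕ → StateSpace n m p}
    (hP : IsAlgorithmOutput N h Phat) :
    ∃ (O : ℕ → Matrix (Fin (2 * n + 1) × Fin p) (Fin n) ℝ)
      (R : ℕ → Matrix (Fin n) (Fin (2 * n) × Fin m) ℝ),
      (∀ j ∈ hankelTimes n N,
        IsLeadingFactorization (hankel (2 * n + 1) (2 * n) h j) (O j) (R j)) ∧
      ∀ k ∈ estimationTimes n N, Phat k =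
        ⟨leftInv (shiftDown (2 * n) p * O (k + 1)) * (shiftUp (2 * n) p * O k),
          R (k + 1) * selectB (2 * n) m, selectC (2 * n + 1) p * O k, h k k⟩ := by
  obtain ⟨U, s, V, O, R, hO, hR, halg⟩ := hP
  refine ⟨O, R, ?_, fun k hk => ?_⟩
  · rintro j ⟨k, hk, rfl | rfl⟩
    · exact ⟨_, _, _, (halg _ hk).1, hO _, hR _⟩
    · exact ⟨_, _, _, (halg k hk).2.1, hO _, hR _⟩
  · obtain ⟨-, -, hA, hB, hC, hD⟩ := halg k hk
    rw [← hA, ← hB, ← hC, ← hD]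

/-- A pair of runs of the algorithm over the horizon `N`, on the Markov parameters `h` and on `h`
perturbed by noise of size at most `level`. Indexing asymptotic statements by runs makes their
constants uniform over all outputs of the algorithm and all noise sequences. -/
structure NoisyRun (n N : ℕ) (h : ℕ → ℕ → Matrix (Fin p) (Fin m) ℝ) where
  exactOutput : ℕ → StateSpace n m p
  noisyOutput : ℕ → StateSpace n m p
  noise : ℕ → ℕ → Matrix (Fin p) (Fin m) ℝ
  level : ℝ
  exact_isOutput : IsAlgorithmOutput N h exactOutput
  noise_bounded : NoiseBounded n N level noise
  noisy_isOutput : IsAlgorithmOutput N (fun k l => h k l + noise k l) noisyOutput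

/-- The time-varying system `P` in the state coordinates `x k ↦ S k x k`. -/
noncomputable def changeBasis (S : ℕ → Matrix (Fin n) (Fin n) ℝ) (P : ℕ → StateSpace n m p)
    (k : ℕ) : StateSpace n m p :=
  ⟨S (k + 1) * (P k).A * (S k)⁻¹, S (k + 1) * (P k).B, (P k).C * (S k)⁻¹, (P k).D⟩

namespace NoisyRun

/-- Vanishing noise level. -/
def smallNoise (n N : ℕ) (h : ℕ → ℕ → Matrix (Fin p) (Fin m) ℝ) : Filter (NoisyRun n N h) :=
  comap level (𝓝[>] 0)

theorem tendsto_level : Tendsto level (smallNoise n N h) (𝓝 0) :=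
  tendsto_comap.mono_right nhdsWithin_le_nhds

theorem hankel_sub_isBigO {k : ℕ} (hk : k ∈ hankelTimes n N) :
    (fun ω : NoisyRun n N h => hankel (2 * n + 1) (2 * n) (fun k l => h k l + ω.noise k l) k -
      hankel (2 * n + 1) (2 * n) h k) =O[smallNoise n N h] level :=
  .of_bound _ (.of_forall fun ω => by
    rw [hankel_add, add_sub_cancel_left]
    exact ω.noise_bounded.norm_hankel_le hk)

theorem noise_diag_isBigO {k : ℕ} (hk : k ∈ estimationTimes n N) :
    (fun ω : NoisyRun n N h => ω.noise k k) =O[smallNoise n N h] level := by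
  obtain ⟨hlow, hup⟩ := hk
  refine isBigO_of_le _ fun ω => ?_
  exact (ω.noise_bounded k k (by omega) le_rfl hlow (by omega)).trans (le_abs_self _)

/-- The basis changes `S`, chosen for each pair of runs, take the noisy estimates to the exact ones
up to an error of the order of the noise level, and are orthogonal up to such an error. -/
structure IsAligned (S : NoisyRun n N h → ℕ → Matrix (Fin n) (Fin n) ℝ) : Prop where
  eventually_isUnit_det : ∀ j ∈ hankelTimes n N, ∀ᶠ ω in smallNoise n N h, IsUnit (S ω j).det
  bounded : ∀ j ∈ hankelTimes n N, (S · j) =O[smallNoise n N h] fun _ => (1 : ℝ)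
  bounded_inv : ∀ j ∈ hankelTimes n N,
    (fun ω => (S ω j)⁻¹) =O[smallNoise n N h] fun _ => (1 : ℝ)
  gram_sub_one : ∀ j ∈ hankelTimes n N,
    (fun ω => (S ω j)ᵀ * S ω j - 1) =O[smallNoise n N h] level
  A_sub : ∀ k ∈ estimationTimes n N,
    (fun ω => (changeBasis (S ω) ω.noisyOutput k).A - (ω.exactOutput k).A)
      =O[smallNoise n N h] level
  B_sub : ∀ k ∈ estimationTimes n N,
    (fun ω => (changeBasis (S ω) ω.noisyOutput k).B - (ω.exactOutput k).B)
      =O[smallNoise n N h] level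
  C_sub : ∀ k ∈ estimationTimes n N,
    (fun ω => (changeBasis (S ω) ω.noisyOutput k).C - (ω.exactOutput k).C)
      =O[smallNoise n N h] level
  D_sub : ∀ k ∈ estimationTimes n N,
    (fun ω => (changeBasis (S ω) ω.noisyOutput k).D - (ω.exactOutput k).D)
      =O[smallNoise n N h] level

theorem exists_isFactorTransform {P : ℕ → StateSpace n m p} {j : ℕ} (hj : j ∈ hankelTimes n N)
    (hobs : IsObservableAt P j (2 * n)) (hctrl : IsControllableAt P j (2 * n))
    {O O' : NoisyRun n N (markov P) → Matrix (Fin (2 * n + 1) × Fin p) (Fin n) ℝ}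
    {R R' : NoisyRun n N (markov P) → Matrix (Fin n) (Fin (2 * n) × Fin m) ℝ}
    (hOR : ∀ ω, IsLeadingFactorization (obsMatrix P j (2 * n + 1) * ctrlMatrix P j (2 * n))
      (O ω) (R ω))
    (hOR' : ∀ ω, IsLeadingFactorization
      (hankel (2 * n + 1) (2 * n) (fun k l => markov P k l + ω.noise k l) j) (O' ω) (R' ω)) :
    ∃ S : NoisyRun n N (markov P) → Matrix (Fin n) (Fin n) ℝ,
      IsFactorTransform (smallNoise n N (markov P)) level O O' R R' S ∧
        (fun ω => (S ω)ᵀ * S ω - 1) =O[smallNoise n N (markov P)] level := by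
  refine IsLeadingFactorization.exists_isFactorTransform tendsto_level hobs.succ hctrl hOR hOR' ?_
  rw [← hankel_markov P (le_of_mem_hankelTimes hj).1]
  exact hankel_sub_isBigO hj

theorem exists_isAligned {P : ℕ → StateSpace n m p}
    (hobs : ∀ k ∈ hankelTimes n N, IsObservableAt P k (2 * n))
    (hctrl : ∀ k ∈ hankelTimes n N, IsControllableAt P k (2 * n)) :
    ∃ S : NoisyRun n N (markov P) → ℕ → Matrix (Fin n) (Fin n) ℝ, IsAligned S := by
  choose O R hOR hexact using fun ω : NoisyRun n N (markov P) => ω.exact_isOutput.exists_factors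
  choose O' R' hOR' hnoisy using fun ω : NoisyRun n N (markov P) =>
    ω.noisy_isOutput.exists_factors
  have hfactor : ∀ j ∈ hankelTimes n N, ∀ ω, IsLeadingFactorization
      (obsMatrix P j (2 * n + 1) * ctrlMatrix P j (2 * n)) (O ω j) (R ω j) := fun j hj ω => by
    rw [← hankel_markov P (le_of_mem_hankelTimes hj).1]
    exact hOR ω j hj
  have hO : ∀ j ∈ hankelTimes n N, (O · j) =O[smallNoise n N (markov P)] fun _ => (1 : ℝ) :=
    fun j hj => IsLeadingFactorization.isBigO_left (hfactor j hj) (isBigO_const_one ℝ _ _)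
  choose! S hS hSorth using fun j (hj : j ∈ hankelTimes n N) =>
    exists_isFactorTransform hj (hobs j hj) (hctrl j hj) (hfactor j hj) fun ω => hOR' ω j hj
  have hmem : ∀ k ∈ estimationTimes n N, k ∈ hankelTimes n N := fun k hk => ⟨k, hk, .inl rfl⟩
  have hmem_succ : ∀ k ∈ estimationTimes n N, k + 1 ∈ hankelTimes n N :=
    fun k hk => ⟨k, hk, .inr rfl⟩
  refine ⟨fun ω j => S j ω, fun j hj => (hS j hj).eventually_isUnit_det,
    fun j hj => (hS j hj).bounded, fun j hj => (hS j hj).bounded_inv, hSorth,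
    fun k hk => ?_, fun k hk => ?_, fun k hk => ?_, fun k hk => ?_⟩ <;>
    simp only [changeBasis, fun ω => hexact ω k hk, fun ω => hnoisy ω k hk]
  · obtain ⟨hunit, hinv⟩ := IsLeadingFactorization.isUnit_det_gram_mul_left_and_isBigO_inv
      (hobs _ (hmem_succ k hk)).injective_shiftDown_mul (hctrl _ (hmem_succ k hk))
      (hfactor _ (hmem_succ k hk))
    exact (hS k (hmem k hk)).isBigO_leftInv_mul_sub tendsto_level (hS (k + 1) (hmem_succ k hk))
      (hO k (hmem k hk)) (hO (k + 1) (hmem_succ k hk)) hunit hinv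
  · simpa only [Matrix.sub_mul, Matrix.mul_assoc] using isBigO_matrix_mul_of_bounded_right
      (hS (k + 1) (hmem_succ k hk)).right_sub (isBigO_const_one ℝ (selectB (2 * n) m) _)
  · simpa only [Matrix.mul_sub, Matrix.mul_assoc] using isBigO_matrix_mul_of_bounded_left
      (isBigO_const_one ℝ (selectC (2 * n + 1) p) _) (hS k (hmem k hk)).left_sub
  · simpa only [add_sub_cancel_left] using noise_diag_isBigO hk

theorem exists_pos_forall_of_eventually {q : NoisyRun n N h → Prop}
    (hq : ∀ᶠ ω in smallNoise n N h, q ω) :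
    ∃ εs : ℝ, 0 < εs ∧ ∀ ω, 0 < ω.level → ω.level ≤ εs → q ω := by
  obtain ⟨εs, hεs, hsub⟩ := mem_nhdsGT_iff_exists_Ioc_subset.1 (eventually_comap.1 hq)
  exact ⟨εs, hεs, fun ω hpos hle => hsub ⟨hpos, hle⟩ ω rfl⟩

theorem IsAligned.exists_bound {S : NoisyRun n N h → ℕ → Matrix (Fin n) (Fin n) ℝ}
    (hS : IsAligned S) :
    ∃ c : ℝ, 0 < c ∧ ∃ εs : ℝ, 0 < εs ∧ ∀ ω : NoisyRun n N h, 0 < ω.level → ω.level ≤ εs →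
      (∀ j ∈ hankelTimes n N, IsUnit (S ω j).det ∧ ‖S ω j‖ ≤ c ∧ ‖(S ω j)⁻¹‖ ≤ c) ∧
      (∀ j ∈ hankelTimes n N, ‖(S ω j)ᵀ * S ω j - 1‖ ≤ c * ω.level) ∧
      ∀ k ∈ estimationTimes n N,
        ‖(changeBasis (S ω) ω.noisyOutput k).A - (ω.exactOutput k).A‖ ≤ c * ω.level ∧
        ‖(changeBasis (S ω) ω.noisyOutput k).B - (ω.exactOutput k).B‖ ≤ c * ω.level ∧
        ‖(changeBasis (S ω) ω.noisyOutput k).C - (ω.exactOutput k).C‖ ≤ c * ω.level ∧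
        ‖(changeBasis (S ω) ω.noisyOutput k).D - (ω.exactOutput k).D‖ ≤ c * ω.level := by
  have hT := finite_hankelTimes n N
  have hK := finite_estimationTimes n N
  obtain ⟨c, hc, hbound, hinv, hgram, hA, hB, hC, hD⟩ := ((eventually_gt_atTop (0 : ℝ)).and <|
    (eventually_forall_norm_le hT hS.bounded).and <|
    (eventually_forall_norm_le hT hS.bounded_inv).and <|
    (eventually_forall_norm_le hT hS.gram_sub_one).and <|
    (eventually_forall_norm_le hK hS.A_sub).and <|
    (eventually_forall_norm_le hK hS.B_sub).and <|
    (eventually_forall_norm_le hK hS.C_sub).and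
    (eventually_forall_norm_le hK hS.D_sub)).exists
  refine ⟨c, hc, ?_⟩
  have hunit := (eventually_all_finite hT).2 hS.eventually_isUnit_det
  obtain ⟨εs, hεs, hall⟩ := exists_pos_forall_of_eventually <| hunit.and <| hbound.and <|
    hinv.and <| hgram.and <| hA.and <| hB.and <| hC.and hD
  refine ⟨εs, hεs, fun ω hpos hle => ?_⟩
  obtain ⟨hunit, hbound, hinv, hgram, hA, hB, hC, hD⟩ := hall ω hpos hle
  simp only [norm_one, mul_one, Real.norm_of_nonneg hpos.le] at hbound hinv hgram hA hB hC hD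
  exact ⟨fun j hj => ⟨hunit j hj, hbound j hj, hinv j hj⟩, hgram,
    fun k hk => ⟨hA k hk, hB k hk, hC k hk, hD k hk⟩⟩

end NoisyRun

end Runs

theorem mainTheorem2_general {n m p : ℕ} (N : ℕ) (P : ℕ → StateSpace n m p)
    (hobs : ∀ k ∈ hankelTimes n N, IsObservableAt P k (2 * n))
    (hctrl : ∀ k ∈ hankelTimes n N, IsControllableAt P k (2 * n)) :
    ∃ c : ℝ, 0 < c ∧ ∃ εs : ℝ, 0 < εs ∧ ∃ ω : ℝ → ℝ, Tendsto ω (𝓝[>] 0) (𝓝 0) ∧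
      ∀ Phat : ℕ → StateSpace n m p, IsAlgorithmOutput N (markov P) Phat →
      ∀ ε : ℝ, 0 < ε → ε ≤ εs →
      ∀ e : ℕ → ℕ → Matrix (Fin p) (Fin m) ℝ, NoiseBounded n N ε e →
      ∀ Ptilde : ℕ → StateSpace n m p,
        IsAlgorithmOutput N (fun k l => markov P k l + e k l) Ptilde →
      ∃ (Peps : ℕ → StateSpace n m p) (S : ℕ → Matrix (Fin n) (Fin n) ℝ),
        IsLyapunovTransformOn (estimationTimes n N) S Ptilde Peps ∧
        (∀ k ∈ estimationTimes n N,
          ‖(Peps k).A - (Phat k).A‖ ≤ c * ε ∧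
          ‖(Peps k).B - (Phat k).B‖ ≤ c * ε ∧
          ‖(Peps k).C - (Phat k).C‖ ≤ c * ε ∧
          ‖(Peps k).D - (Phat k).D‖ ≤ c * ε) ∧
        (∀ k ∈ estimationTimes n N, ∀ j ∈ ({k, k + 1} : Set ℕ),
          ‖(S j)ᵀ * S j - 1‖ ≤ ω ε) := by
  obtain ⟨S, hS⟩ := NoisyRun.exists_isAligned hobs hctrl
  obtain ⟨c, hc, εs, hεs, hbound⟩ := hS.exists_bound
  have hω : Tendsto (fun ε => c * ε) (𝓝[>] 0) (𝓝 0) :=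
    ((continuous_const_mul c).tendsto' 0 0 (mul_zero c)).mono_left nhdsWithin_le_nhds
  refine ⟨c, hc, εs, hεs, fun ε => c * ε, hω, fun Phat hPhat ε hpos hle e he Ptilde hPtilde => ?_⟩
  let run : NoisyRun n N (markov P) := ⟨Phat, Ptilde, e, ε, hPhat, he, hPtilde⟩
  obtain ⟨hlyapunov, horth, herror⟩ := hbound run hpos hle
  exact ⟨changeBasis (S run) Ptilde, S run,
    ⟨⟨c, fun k hk j hj => hlyapunov j ⟨k, hk, hj⟩⟩, fun _ _ => ⟨rfl, rfl, rfl, rfl⟩⟩, herror,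
    fun k hk j hj => horth j ⟨k, hk, hj⟩⟩

theorem mainTheorem2 {n m p σ : ℕ} (N : ℕ) (modes : Fin σ → StateSpace n m p)
    (φ : ℕ → Fin σ)
    (hstable : ∀ j, (modes j).IsBIBOStable)
    (hdegree : ∀ j, (modes j).mcmillanDegree = n)
    (hdwell : MinDwellAtLeast N φ n) :
    ∃ c : ℝ, 0 < c ∧ ∃ εs : ℝ, 0 < εs ∧ ∃ ω : ℝ → ℝ, Tendsto ω (𝓝[>] 0) (𝓝 0) ∧
      ∀ Phat : ℕ → StateSpace n m p,
        IsAlgorithmOutput N (markov (switchedSystem modes φ)) Phat →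
      ∀ ε : ℝ, 0 < ε → ε ≤ εs →
      ∀ e : ℕ → ℕ → Matrix (Fin p) (Fin m) ℝ, NoiseBounded n N ε e →
      ∀ Ptilde : ℕ → StateSpace n m p,
        IsAlgorithmOutput N (fun k l => markov (switchedSystem modes φ) k l + e k l) Ptilde →
      ∃ (Peps : ℕ → StateSpace n m p) (S : ℕ → Matrix (Fin n) (Fin n) ℝ),
        IsLyapunovTransformOn (estimationTimes n N) S Ptilde Peps ∧
        (∀ k ∈ estimationTimes n N,
          ‖(Peps k).A - (Phat k).A‖ ≤ c * ε ∧
          ‖(Peps k).B - (Phat k).B‖ ≤ c * ε ∧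
          ‖(Peps k).C - (Phat k).C‖ ≤ c * ε ∧
          ‖(Peps k).D - (Phat k).D‖ ≤ c * ε) ∧
        (∀ k ∈ estimationTimes n N, ∀ j ∈ ({k, k + 1} : Set ℕ),
          ‖(S j)ᵀ * S j - 1‖ ≤ ω ε) := by
  refine mainTheorem2_general N (switchedSystem modes φ) (fun k hk => ?_) fun k hk => ?_ <;>
    obtain ⟨hlow, hup⟩ := le_of_mem_hankelTimes hk
  · exact isObservableAt_switchedSystem hdegree hdwell (by omega) (by omega)
  · exact isControllableAt_switchedSystem hdegree hdwell hlow (by omega)
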